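/- Let $n\ge 1$, $T>0$, $\gamma>0$, let $\sigma\in\mathbb R^{n\times n}$ be symmetric positive definite with largest eigenvalue $\overline\lambda(\sigma)$, and let $B$ be a standard $n$-dimensional Brownian motion. For $l\ge 0$ set $$C_l=\{\phi\in C^2(\mathbb R^n;\mathbb R):\ 0\le D^2\phi< l\,\mathrm{Id},\ \phi(0)=0\}$$ (inequalities between symmetric matrices). Assume $0\le l<\frac{1}{\overline\lambda(\sigma)^2\gamma T}$. For $\phi\in C_l$ and $(t,z,\xi)\in[0,T]\times\mathbb R^n\times\mathbb R^n$ define $$E(t,z)=\frac1\gamma\ln\mathbb E\big[\exp\big(\gamma\phi(z+\sigma(B_T-B_t))\big)\big],\qquad J(t,\xi,z)=E(t,z)+\frac{|\sigma^{-1}(\xi-z)|^2}{2\gamma(T-t)},$$ where for $t=T$ the last term is read as $0$ if $z=\xi$ and $+\infty$ otherwise, and $$\chi(t,\xi)=\operatorname{argmin}_{z\in\mathbb R^n}J(t,\xi,z),\qquad \Gamma(t,\xi)=E(t,\chi(t,\xi)),\qquad P(t,\xi)=(DE)^\top(t,\chi(t,\xi)),$$ where $D$ and $D^2$ denote the Jacobian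 (a row vector for a scalar function) and the Hessian in the space variable. Let $\phi\in C_l$. Then the following hold. 1. The expectation defining $E$ is finite and $E(t,\cdot)$ is differentiable, for every $t\in[0,T]$. For every $t\in[0,T)$ there is $m>0$ such that for all $\xi$ the function $z\mapsto J(t,\xi,z)$ is $m$-strongly convex. For every $(t,\xi)\in[0,T]\times\mathbb R^n$ the function $z\mapsto J(t,\xi,z)$ has a unique minimizer, which is $\chi(t,\xi)$. 2. $\chi,\Gamma,P$ are of class $C^{1,2}([0,T)\times\mathbb R^n)\cap C^0([0,T]\times\mathbb R^n)$ (the time derivative at $t=0$ being one-sided), $D\chi(t,\xi)$ is invertible for $t<T$, and on $[0,T)\times\mathbb R^n$, for $i=1,\dots,n$, $$\partial_t\Gamma+\tfrac12\mathrm{tr}\big(\sigma^\top(D\chi)^{-\top}D^2\Gamma\,(D\chi)^{-1}\sigma\big)=\tfrac{\gamma}{2}|\sigma P|^2,$$ $$\partial_t\chi^i+\tfrac12\mathrm{tr}\big(\sigma^\top(D\chi)^{-\top}D^2\chi^i\,(D\chi)^{-1}\sigma\big)=\gamma(\sigma^2P)^i,$$ $$\partial_tP^i+\tfrac12\mathrm{tr}\big(\sigma^\top(D\chi)^{-\top}D^2P^i\,(D\chi)^{-1}\sigma\big)=0,$$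 with terminal conditions $P(T,\xi)=(D\phi)^\top(\xi)$, $\chi(T,\xi)=\xi$, $\Gamma(T,\xi)=\phi(\xi)$. Moreover, write $\Gamma^\phi,\chi^\phi$ for the functions attached to $\phi$. If $\phi_k,\phi\in C_l$ and $\phi_k\to\phi$ uniformly on compact subsets of $\mathbb R^n$, then $(\Gamma^{\phi_k}(0,0),\chi^{\phi_k}(0,0))\to(\Gamma^{\phi}(0,0),\chi^{\phi}(0,0))$. -/

import Mathlib

noncomputable section

namespace KyleBack

open MeasureTheory ProbabilityTheory Set
open scoped NNReal

/-- The Euclidean space of column vectors with `n` real components. -/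
abbrev Vec (n : ℕ) : Type := EuclideanSpace ℝ (Fin n)

/-- The matrix-vector product `A x`, as a vector of Euclidean space. -/
def act {n : ℕ} (A : Matrix (Fin n) (Fin n) ℝ) (x : Vec n) : Vec n :=
  Matrix.toEuclideanCLM (𝕜 := ℝ) A x

/-- The largest eigenvalue of a symmetric real matrix. -/
def maxEigenvalue {n : ℕ} (A : Matrix (Fin n) (Fin n) ℝ) : ℝ :=
  sSup (spectrum ℝ A)

/-- The partial derivative of `f` at `x` with respect to the `i`-th coordinate. -/
def partialDeriv {n : ℕ} (i : Fin n) (f : Vec n → ℝ) (x : Vec n) : ℝ :=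
  fderiv ℝ f x (EuclideanSpace.single i 1)

/-- The Hessian matrix of a scalar function. -/
def hessian {n : ℕ} (f : Vec n → ℝ) (x : Vec n) : Matrix (Fin n) (Fin n) ℝ :=
  Matrix.of fun i j => partialDeriv i (partialDeriv j f) x

/-- The Jacobian matrix of a vector field: the `i`-th row is the derivative of the `i`-th
component. -/
def jacobian {n : ℕ} (f : Vec n → Vec n) (x : Vec n) : Matrix (Fin n) (Fin n) ℝ :=
  Matrix.of fun i j => partialDeriv j (fun y => f y i) x

/-- The class `C_l` of `C²` functions with `φ(0) = 0` and `0 ≤ D²φ < l Id` in the Loewner order. -/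
def ClassC (n : ℕ) (l : ℝ) : Set (Vec n → ℝ) :=
  {φ | ContDiff ℝ 2 φ ∧
    (∀ x, (hessian φ x).PosSemidef ∧
      (l • (1 : Matrix (Fin n) (Fin n) ℝ) - hessian φ x).PosDef) ∧
    φ 0 = 0}

/-- Standard `n`-dimensional Brownian motion: the components are independent standard real
Brownian motions. -/
structure IsBrownianVec {n : ℕ} {Ω : Type*} [MeasurableSpace Ω] (B : ℝ≥0 → Ω → Vec n)
    (P : Measure Ω) : Prop where
  isBrownianReal : ∀ i : Fin n, IsBrownianReal (fun t ω => B t ω i) P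
  indep : iIndepFun (fun (i : Fin n) (ω : Ω) (t : ℝ≥0) => B t ω i) P

section Potentials

variable {n : ℕ} {Ω : Type*} [MeasurableSpace Ω] (P : Measure Ω) (B : ℝ≥0 → Ω → Vec n)
  (σ : Matrix (Fin n) (Fin n) ℝ) (γ T : ℝ) (φ : Vec n → ℝ)

/-- The random variable `exp (γ φ (z + σ (B_T - B_t)))`. -/
def expPayoff (t : ℝ) (z : Vec n) (ω : Ω) : ℝ :=
  Real.exp (γ * φ (z + act σ (B T.toNNReal ω - B t.toNNReal ω)))

/-- `E(t,z) = (1/γ) ln 𝔼[exp (γ φ (z + σ (B_T - B_t)))]`. -/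
def E (t : ℝ) (z : Vec n) : ℝ :=
  1 / γ * Real.log (∫ ω, expPayoff B σ γ T φ t z ω ∂P)

/-- The function `E(t,z) + |σ⁻¹(ξ - z)|² / (2γ(T-t))`, meaningful for `t < T`. -/
def objective (t : ℝ) (ξ z : Vec n) : ℝ :=
  E P B σ γ T φ t z + 1 / (2 * γ * (T - t)) * ‖act σ⁻¹ (ξ - z)‖ ^ 2

open Classical in
/-- The extended-real-valued function that is minimized. For `t < T` it is `objective`; for `t = T`
the penalty term `|σ⁻¹(ξ - z)|² / 0` is read as `0` if `z = ξ` and as `+∞` otherwise. -/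
def extObjective (t : ℝ) (ξ z : Vec n) : EReal :=
  if t < T then (objective P B σ γ T φ t ξ z : EReal)
  else if z = ξ then (E P B σ γ T φ t z : EReal)
  else ⊤

/-- `χ(t,ξ)`: a minimizer in `z` of the (extended) objective; an arbitrary point if there is
none. -/
def chi (t : ℝ) (ξ : Vec n) : Vec n :=
  Classical.epsilon fun z =>
    ∀ w, extObjective P B σ γ T φ t ξ z ≤ extObjective P B σ γ T φ t ξ w

/-- `Γ(t,ξ) = E(t, χ(t,ξ))`. -/
def Gam (t : ℝ) (ξ : Vec n) : ℝ :=
  E P B σ γ T φ t (chi P B σ γ T φ t ξ)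

/-- `P(t,ξ)`, the gradient in `z` of `E` at `(t, χ(t,ξ))`. -/
def price (t : ℝ) (ξ : Vec n) : Vec n :=
  gradient (E P B σ γ T φ t) (chi P B σ γ T φ t ξ)

end Potentials

/-- The time derivative of `u` on `[0,T)`; it is one-sided at `t = 0`. -/
def timeDeriv {n : ℕ} (T : ℝ) (u : ℝ → Vec n → ℝ) (t : ℝ) (x : Vec n) : ℝ :=
  derivWithin (fun s => u s x) (Ico 0 T) t

/-- `u` is of class `C^{1,2}` on `[0,T) × ℝⁿ`: once differentiable in time, twice in space, and
`u` and all these derivatives are jointly continuous on `[0,T) × ℝⁿ`. -/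
structure IsC12 {n : ℕ} (T : ℝ) (u : ℝ → Vec n → ℝ) : Prop where
  differentiable_time : ∀ t ∈ Ico 0 T, ∀ x,
    DifferentiableWithinAt ℝ (fun s => u s x) (Ico 0 T) t
  contDiff_space : ∀ t ∈ Ico 0 T, ContDiff ℝ 2 (u t)
  continuousOn : ContinuousOn (fun p : ℝ × Vec n => u p.1 p.2) (Ico 0 T ×ˢ univ)
  continuousOn_time :
    ContinuousOn (fun p : ℝ × Vec n => timeDeriv T u p.1 p.2) (Ico 0 T ×ˢ univ)
  continuousOn_space : ∀ i,
    ContinuousOn (fun p : ℝ × Vec n => partialDeriv i (u p.1) p.2) (Ico 0 T ×ˢ univ)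
  continuousOn_space₂ :
    ContinuousOn (fun p : ℝ × Vec n => hessian (u p.1) p.2) (Ico 0 T ×ˢ univ)

/-- `u` is continuous on `[0,T] × ℝⁿ`. -/
def IsC0 {n : ℕ} (T : ℝ) (u : ℝ → Vec n → ℝ) : Prop :=
  ContinuousOn (fun p : ℝ × Vec n => u p.1 p.2) (Icc 0 T ×ˢ univ)

/-- The operator `∂u/∂t + ½ tr(σᵀ (Dχ)⁻ᵀ D²u (Dχ)⁻¹ σ)` for a given vector field `χ`. -/
def parabolicOp {n : ℕ} (σ : Matrix (Fin n) (Fin n) ℝ) (T : ℝ) (χ : ℝ → Vec n → Vec n)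
    (u : ℝ → Vec n → ℝ) (t : ℝ) (ξ : Vec n) : ℝ :=
  timeDeriv T u t ξ +
    1 / 2 * Matrix.trace
      (σ.transpose * ((jacobian (χ t) ξ)⁻¹).transpose * hessian (u t) ξ *
        (jacobian (χ t) ξ)⁻¹ * σ)

end KyleBack

end

open MeasureTheory ProbabilityTheory Set Filter Topology KyleBack
open scoped NNReal

/-!
Since the increment `B_T - B_t` is Gaussian, `γ E(t,z)` is the logarithm of the integral of
`exp (γ φ (z + √(T-t) σ y))` against the standard Gaussian law. The function of `(t,z)` obtained in
this way is called `potential` below (`E_eq_potential`), and all work is done on it. The strict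
bound on `l` makes the integral converge not only on `[0,T]` but on an open set of times `t < T`
containing `0` (`potDomain`, `IsPayoff.growth`), so that every one-sided derivative at `t = 0`
comes from a derivative in the interior of a domain.

*Smoothness and the heat equation.* Expanding the square in the Gaussian density writes the heat
semigroup as an explicit factor times a Laplace transform in finitely many parameters
(`heat_eq_mul_gaussLaplace`). Laplace transforms are smooth in the interior of their domain
(`contDiffOn_laplace`), and the heat equation is read off the same formula (`pd_heat`). By the
Hopf–Cole transformation (`heatOp_of_exp`) the potential solves the quadratic equation recorded in
`IsBurgersPotential`.

*The optimal map.* Since `φ` is convex, so is the potential `E(t,·)`, by Hölder's inequality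
(`convexOn_log_integral_exp`). Hence `J(t,ξ,·)` is strongly convex, with first-order condition
`ξ = Ψ(t,z)`, where `Ψ(t,z) = z + γ (T-t) σ² ∇E(t,z)` (`invMap`). Monotonicity of `∇E` makes `Ψ(t,·)`
expanding for the norm `|σ⁻¹ ·|` (`IsAdmissible.le_norm_invMap_sub`), so its inverse `optMap` is
well defined. The same estimate shows that the derivative of `Ψ` in space is invertible, and the
inverse function theorem makes the inverse smooth for `t < T` (`IsAdmissible.contDiffOn_optMap`).
Finally, it bounds the distance from the inverse image of `ξ` to any `z` by that from `ξ` to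
`Ψ(t,z)` (`IsAdmissible.norm_optMap_sub_le`). Pointwise convergence of convex functions forces
convergence of their gradients (`tendsto_fderiv_of_convexOn`), and these two facts give joint
continuity in `(t,ξ,φ)` (`IsAdmissible.tendsto_optMap`): continuity up to `t = T` and stability
under changes of `φ` are two instances of one statement.

*The system.* Write `A = ∂ₜ + ½ ∑ᵢ ∂²_{σeᵢ}` for the backward heat operator. Since the potential
solves its quadratic equation, `Ψ` satisfies `A Ψ = -γ ⟨σ∇E, σ∇Ψ⟩`
(`IsBurgersPotential.heatOp_invMap`), and the change of variables `ξ = Ψ(t,z)` turns the operator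
of the system applied to `u`, with `v(t,z) = u(t,Ψ(t,z))`, into `A v + γ ⟨σ∇E, σ∇v⟩`
(`IsBurgersPotential.parabolic_of_comp`). The three equations are the cases where `v` is `E`, a
coordinate of `z`, and a coordinate of `∇E`.
-/

namespace KyleBack

section

/-! ### The Gaussian law of the Brownian increments -/

open scoped RealInnerProductSpace

/-- The increments of a standard Brownian motion are rescaled standard Gaussian vectors. -/
lemma IsBrownianVec.map_sub {n : ℕ} {Ω : Type*} [MeasurableSpace Ω] {P : Measure Ω}
    [IsProbabilityMeasure P] {B : ℝ≥0 → Ω → Vec n} (hB : IsBrownianVec B P) (s t : ℝ≥0) :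
    AEMeasurable (fun ω => B s ω - B t ω) P ∧
      P.map (fun ω => B s ω - B t ω) =
        (stdGaussian (Vec n)).map fun w => √(nndist s.1 t.1 : ℝ) • w := by
  set v := nndist s.1 t.1 with hv
  have hlaw (i : Fin n) := (hB.isBrownianReal i).hasLaw_sub s t
  have haem (i : Fin n) : AEMeasurable (fun ω => B s ω i - B t ω i) P := (hlaw i).aemeasurable
  have haem' : AEMeasurable (fun ω i => B s ω i - B t ω i) P := aemeasurable_pi_lambda _ haem
  have hEq : (fun ω => B s ω - B t ω) =
      (WithLp.toLp 2) ∘ (fun ω (i : Fin n) => B s ω i - B t ω i) := by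
    ext ω i; simp
  have hmeas : AEMeasurable (fun ω => B s ω - B t ω) P := by
    rw [hEq]
    exact (Measurable.comp_aemeasurable (by fun_prop) haem')
  refine ⟨hmeas, ?_⟩
  have hind : iIndepFun (fun (i : Fin n) ω => B s ω i - B t ω i) P :=
    hB.indep.comp (fun _ f => f s - f t) (fun _ => by fun_prop)
  have h1 := (iIndepFun_iff_map_fun_eq_pi_map haem).1 hind
  have h2 (i : Fin n) : P.map (fun ω => B s ω i - B t ω i)
      = (gaussianReal 0 1).map (fun x => √(v : ℝ) * x) := by
    rw [gaussianReal_map_const_mul]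
    have := (hlaw i).map_eq
    rw [← hv] at this
    refine Eq.trans this ?_
    congr 1
    · simp
    · ext; simp
  have hm : MeasurePreserving (WithLp.toLp 2) (Measure.pi fun _ => gaussianReal 0 1)
      (stdGaussian (Vec n)) := ⟨by fun_prop, map_pi_eq_stdGaussian⟩
  rw [hEq, ← AEMeasurable.map_map_of_aemeasurable (by fun_prop) haem', h1]
  simp_rw [h2]
  rw [← Measure.pi_map_pi (fun _ => by fun_prop), ← map_pi_eq_stdGaussian,
    Measure.map_map (by fun_prop) (by fun_prop), Measure.map_map (by fun_prop) (by fun_prop)]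
  congr 1

/-- The normalizing constant of the standard Gaussian density. -/
noncomputable def gaussConst (n : ℕ) : ℝ := (2 * Real.pi) ^ (-(n : ℝ) / 2)

lemma gaussConst_pos (n : ℕ) : 0 < gaussConst n := by
  unfold gaussConst; positivity

/-- The density of the standard Gaussian measure, identified through its characteristic
function. -/
lemma stdGaussian_eq_withDensity (n : ℕ) :
    stdGaussian (Vec n) = (volume : Measure (Vec n)).withDensity
      fun w => ENNReal.ofReal (gaussConst n * Real.exp (-(1 / 2) * ‖w‖ ^ 2)) := by
  have hint : Integrable (fun w : Vec n => gaussConst n * Real.exp (-(1 / 2) * ‖w‖ ^ 2)) := by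
    have h := (GaussianFourier.integrable_cexp_neg_mul_sq_norm_add (V := Vec n)
      (b := (1 / 2 : ℂ)) (by norm_num) 0 0).norm
    refine Integrable.const_mul (h.congr (ae_of_all _ fun w => ?_)) _
    simp only [Complex.norm_exp]
    congr 1
    simp [← Complex.ofReal_pow]
  have hfin : IsFiniteMeasure ((volume : Measure (Vec n)).withDensity
      fun w => ENNReal.ofReal (gaussConst n * Real.exp (-(1 / 2) * ‖w‖ ^ 2))) :=
    isFiniteMeasure_withDensity_ofReal hint.2
  apply Measure.ext_of_charFun
  ext t
  rw [charFun_stdGaussian, charFun_apply, integral_withDensity_eq_integral_toReal_smul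
    (by fun_prop) (ae_of_all _ fun _ => ENNReal.ofReal_lt_top)]
  have hp (w : Vec n) : (0 : ℝ) ≤ gaussConst n * Real.exp (-(1 / 2) * ‖w‖ ^ 2) :=
    mul_nonneg (gaussConst_pos n).le (Real.exp_pos _).le
  have h := GaussianFourier.integral_cexp_neg_mul_sq_norm_add (V := Vec n)
      (b := (1 / 2 : ℂ)) (by norm_num) Complex.I t
  have : ∀ w : Vec n, (ENNReal.ofReal (gaussConst n * Real.exp (-(1 / 2) * ‖w‖ ^ 2))).toReal •
      Complex.exp (⟪w, t⟫ * Complex.I) = (gaussConst n : ℂ) *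
        Complex.exp (-(1 / 2) * ‖w‖ ^ 2 + Complex.I * ⟪t, w⟫) := by
    intro w
    rw [ENNReal.toReal_ofReal (hp w), Complex.real_smul, real_inner_comm, Complex.exp_add]
    push_cast
    ring_nf
  simp_rw [this]
  rw [integral_const_mul, h, gaussConst]
  have h2 : (((2 * Real.pi) ^ (-(n : ℝ) / 2) : ℝ) : ℂ) * (Real.pi / (1 / 2 : ℂ)) ^ ((n : ℂ) / 2)
      = 1 := by
    rw [Complex.ofReal_cpow (by positivity)]
    have : (Real.pi / (1 / 2 : ℂ)) = ((2 * Real.pi : ℝ) : ℂ) := by push_cast; ring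
    rw [this, ← Complex.cpow_add]
    · push_cast
      rw [neg_div, neg_add_cancel, Complex.cpow_zero]
    · exact_mod_cast (by positivity : (2 * Real.pi) ≠ 0)
  rw [finrank_euclideanSpace, Fintype.card_fin, ← mul_assoc, h2, one_mul]
  congr 1
  rw [Complex.I_sq]; ring

lemma integral_stdGaussian {n : ℕ} (g : Vec n → ℝ) :
    ∫ w, g w ∂(stdGaussian (Vec n)) =
      gaussConst n * ∫ w, Real.exp (-(1 / 2) * ‖w‖ ^ 2) * g w := by
  rw [stdGaussian_eq_withDensity, integral_withDensity_eq_integral_toReal_smul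
    (by fun_prop) (ae_of_all _ fun _ => ENNReal.ofReal_lt_top), ← integral_const_mul]
  congr 1; ext w
  rw [ENNReal.toReal_ofReal (mul_nonneg (gaussConst_pos n).le (Real.exp_pos _).le), smul_eq_mul,
    mul_assoc]

lemma integrable_exp_quadratic {n : ℕ} {a : ℝ} (ha : 0 < a) (b : ℝ) :
    Integrable fun w : Vec n => Real.exp (-a * ‖w‖ ^ 2 + b * ‖w‖) := by
  have h := (GaussianFourier.integrable_cexp_neg_mul_sq_norm_add (V := Vec n)
    (b := ((a / 2 : ℝ) : ℂ)) (by rw [Complex.ofReal_re]; positivity) 0 0).norm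
  refine (h.const_mul (Real.exp (b ^ 2 / (2 * a)))).mono' (by fun_prop) (ae_of_all _ fun w => ?_)
  have h1 : ‖Complex.exp (-((a / 2 : ℝ) : ℂ) * (‖w‖ : ℂ) ^ 2 + 0 * (⟪(0 : Vec n), w⟫ : ℝ))‖
      = Real.exp (-(a / 2) * ‖w‖ ^ 2) := by
    rw [Complex.norm_exp]
    congr 1
    simp [← Complex.ofReal_pow]
  rw [h1, ← Real.exp_add, Real.norm_eq_abs, abs_of_pos (Real.exp_pos _), Real.exp_le_exp]
  have : b ^ 2 / (2 * a) + -(a / 2) * ‖w‖ ^ 2 - (-a * ‖w‖ ^ 2 + b * ‖w‖)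
      = (a * ‖w‖ - b) ^ 2 / (2 * a) := by field_simp; ring
  nlinarith [div_nonneg (sq_nonneg (a * ‖w‖ - b)) (by positivity : 0 ≤ 2 * a)]

lemma integrable_stdGaussian_exp_quadratic {n : ℕ} {a : ℝ} (ha : a < 1 / 2) (b c : ℝ) :
    Integrable (fun w : Vec n => Real.exp (a * ‖w‖ ^ 2 + b * ‖w‖ + c)) (stdGaussian (Vec n)) := by
  rw [stdGaussian_eq_withDensity, integrable_withDensity_iff_integrable_smul'
    (by fun_prop) (ae_of_all _ fun _ => ENNReal.ofReal_lt_top)]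
  have := (integrable_exp_quadratic (n := n) (sub_pos.2 ha) b).const_mul
    (gaussConst n * Real.exp c)
  refine this.congr (ae_of_all _ fun w => ?_)
  beta_reduce
  rw [ENNReal.toReal_ofReal (mul_nonneg (gaussConst_pos n).le (Real.exp_pos _).le), smul_eq_mul,
    mul_assoc, mul_assoc, ← Real.exp_add, ← Real.exp_add]
  ring_nf

end

section Laplace

/-! ### Smoothness of Laplace transforms -/

universe u

/-- In finite dimension the exponential growth `exp (δ ‖L‖)` of linear forms `L` is controlled by
the values `exp (L v)` at finitely many small vectors `v`. -/
lemma exists_exp_norm_le_sum_exp (Θ : Type*) [NormedAddCommGroup Θ] [NormedSpace ℝ Θ]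
    [FiniteDimensional ℝ Θ] {ε : ℝ} (hε : 0 < ε) :
    ∃ δ > 0, ∃ s : Finset Θ, (∀ v ∈ s, ‖v‖ < ε) ∧
      ∀ L : Θ →L[ℝ] ℝ, Real.exp (δ * ‖L‖) ≤ ∑ v ∈ s, Real.exp (L v) := by
  classical
  let b := Module.finBasis ℝ Θ
  obtain ⟨C, hC, hb⟩ := b.exists_opNorm_le (F := ℝ)
  set N : ℝ := 1 + ∑ i, ‖b i‖
  have hN : 0 < N := by positivity
  have hbN (i) : ‖b i‖ < N := by
    have := Finset.single_le_sum (f := fun i => ‖b i‖) (fun _ _ => norm_nonneg _)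
      (Finset.mem_univ i)
    simp only [N]; linarith
  set η : ℝ := ε / N
  have hη : 0 < η := by positivity
  let s : Finset Θ := insert 0 (Finset.univ.image (fun i => η • b i) ∪
    Finset.univ.image fun i => -(η • b i))
  refine ⟨η / (2 * C), by positivity, s, ?_, fun L => ?_⟩
  · have hi (i) : ‖η • b i‖ < ε := by
      rw [norm_smul, Real.norm_of_nonneg hη.le]
      calc η * ‖b i‖ < η * N := by gcongr; exact hbN i
        _ = ε := by simp only [η]; field_simp
    intro v hv
    simp only [s, Finset.mem_insert, Finset.mem_union, Finset.mem_image, Finset.mem_univ,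
      true_and] at hv
    rcases hv with rfl | ⟨i, rfl⟩ | ⟨i, rfl⟩
    · simpa using hε
    · exact hi i
    · rw [norm_neg]; exact hi i
  · have hmem {v : Θ} (hv : v ∈ s) : Real.exp (L v) ≤ ∑ v ∈ s, Real.exp (L v) :=
      Finset.single_le_sum (f := fun v => Real.exp (L v)) (fun _ _ => (Real.exp_pos _).le) hv
    -- the norm of `L` is at most `C` times its largest value on the basis, so that either `L = 0`
    -- or some basis vector captures the fraction `1 / (2 * C)` of the norm
    by_cases h : ∀ i, ‖L (b i)‖ ≤ ‖L‖ / (2 * C)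
    · have h1 := hb (u := L) (by positivity) h
      have h0 : ‖L‖ = 0 := by
        have : C * (‖L‖ / (2 * C)) = ‖L‖ / 2 := by field_simp
        linarith [norm_nonneg L]
      rw [h0, mul_zero]
      simpa using hmem (v := 0) (by simp [s])
    · push Not at h
      obtain ⟨i, hi⟩ := h
      have h1 : η / (2 * C) * ‖L‖ ≤ η * |L (b i)| := by
        rw [div_mul_eq_mul_div, mul_div_assoc]
        exact mul_le_mul_of_nonneg_left hi.le hη.le
      refine (Real.exp_le_exp.2 h1).trans ?_
      rcases abs_cases (L (b i)) with ⟨h2, -⟩ | ⟨h2, -⟩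
      · rw [h2]
        have := hmem (v := η • b i) (by simp [s])
        simpa using this
      · rw [h2]
        have := hmem (v := -(η • b i)) (by simp [s])
        simpa using this

/-- The first moment of the statistic is exponentially dominated, locally uniformly in the
parameter. -/
lemma exists_integrable_bound_laplace {α Θ : Type*} [MeasurableSpace α] {ν : Measure α}
    [NormedAddCommGroup Θ] [NormedSpace ℝ Θ] [FiniteDimensional ℝ Θ]
    {S : α → Θ →L[ℝ] ℝ} {g : α → ℝ} {U : Set Θ} (hU : IsOpen U)
    (hg : ∀ y, 0 ≤ g y)
    (hint : ∀ θ ∈ U, Integrable (fun y => Real.exp (S y θ) * g y) ν) {θ₀ : Θ} (hθ : θ₀ ∈ U) :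
    ∃ δ > 0, ∃ bound : α → ℝ, Integrable bound ν ∧ ∀ y, ∀ θ ∈ Metric.ball θ₀ δ,
      Real.exp (S y θ) * (‖S y‖ * g y) ≤ bound y := by
  obtain ⟨ε, hε, hball⟩ := Metric.isOpen_iff.1 hU θ₀ hθ
  obtain ⟨δ, hδ, s, hs, hexp⟩ := exists_exp_norm_le_sum_exp Θ hε
  refine ⟨δ / 2, by positivity,
    fun y => 2 / δ * ∑ v ∈ s, Real.exp (S y (θ₀ + v)) * g y, ?_, ?_⟩
  · refine (integrable_finsetSum _ fun v hv => hint _ (hball ?_)).const_mul _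
    simpa [Metric.mem_ball, dist_eq_norm] using hs v hv
  · intro y θ hθ
    have hgy := hg y
    have h1 : S y θ ≤ S y θ₀ + δ / 2 * ‖S y‖ := by
      have h2 : S y (θ - θ₀) ≤ ‖S y‖ * ‖θ - θ₀‖ := (le_abs_self _).trans ((S y).le_opNorm _)
      rw [Metric.mem_ball, dist_eq_norm] at hθ
      rw [map_sub] at h2
      nlinarith [norm_nonneg (S y)]
    have h3 : ‖S y‖ ≤ 2 / δ * Real.exp (δ / 2 * ‖S y‖) := by
      have := Real.add_one_le_exp (δ / 2 * ‖S y‖)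
      calc ‖S y‖ = 2 / δ * (δ / 2 * ‖S y‖) := by field_simp
        _ ≤ _ := by gcongr; linarith
    calc Real.exp (S y θ) * (‖S y‖ * g y)
        ≤ Real.exp (S y θ₀ + δ / 2 * ‖S y‖) *
          (2 / δ * Real.exp (δ / 2 * ‖S y‖) * g y) := by gcongr
      _ = 2 / δ * (Real.exp (S y θ₀) * Real.exp (δ * ‖S y‖) * g y) := by
        rw [Real.exp_add]
        have : Real.exp (δ * ‖S y‖) = Real.exp (δ / 2 * ‖S y‖) * Real.exp (δ / 2 * ‖S y‖) := by
          rw [← Real.exp_add]; ring_nf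
        rw [this]; ring
      _ ≤ 2 / δ * (Real.exp (S y θ₀) * (∑ v ∈ s, Real.exp (S y v)) * g y) := by
        gcongr; exact hexp _
      _ = _ := by
        congr 1
        rw [Finset.mul_sum, Finset.sum_mul]
        simp_rw [map_add, Real.exp_add]

-- `F` and `Θ →L[ℝ] F` must live in one universe for the induction in `contDiffOn_laplace`
variable {α : Type*} [MeasurableSpace α] {ν : Measure α} {Θ F : Type u}
  [NormedAddCommGroup Θ] [NormedSpace ℝ Θ]
  [NormedAddCommGroup F] [NormedSpace ℝ F]

/-- The Laplace transform of the vector measure `G dν` along the statistic `S`. -/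
noncomputable def laplace (ν : Measure α) (S : α → Θ →L[ℝ] ℝ) (G : α → F) (θ : Θ) : F :=
  ∫ y, Real.exp (S y θ) • G y ∂ν

variable {S : α → Θ →L[ℝ] ℝ} {G : α → F} {U : Set Θ}

lemma aestronglyMeasurable_exp_smul (hS : AEStronglyMeasurable S ν)
    (hG : AEStronglyMeasurable G ν) (θ : Θ) :
    AEStronglyMeasurable (fun y => Real.exp (S y θ) • G y) ν :=
  (Real.continuous_exp.comp_aestronglyMeasurable
    ((ContinuousLinearMap.apply ℝ ℝ θ).continuous.comp_aestronglyMeasurable hS)).smul hG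

lemma aestronglyMeasurable_smulRight (hS : AEStronglyMeasurable S ν)
    (hG : AEStronglyMeasurable G ν) :
    AEStronglyMeasurable (fun y => (S y).smulRight (G y)) ν :=
  (ContinuousLinearMap.smulRightL ℝ Θ F).aestronglyMeasurable_comp₂ hS hG

variable [FiniteDimensional ℝ Θ]

/-- Differentiating a Laplace transform multiplies the density by the statistic. -/
lemma hasFDerivAt_laplace (hU : IsOpen U)
    (hS : AEStronglyMeasurable S ν) (hG : AEStronglyMeasurable G ν)
    (hint : ∀ θ ∈ U, Integrable (fun y => Real.exp (S y θ) * ‖G y‖) ν) {θ₀ : Θ} (hθ : θ₀ ∈ U) :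
    HasFDerivAt (laplace ν S G) (laplace ν S (fun y => (S y).smulRight (G y)) θ₀) θ₀ := by
  obtain ⟨δ, hδ, bound, hbi, hb⟩ :=
    exists_integrable_bound_laplace hU (fun y => norm_nonneg (G y)) hint hθ
  refine hasFDerivAt_integral_of_dominated_of_fderiv_le (bound := bound)
    (F' := fun θ y => Real.exp (S y θ) • (S y).smulRight (G y))
    (Metric.ball_mem_nhds θ₀ hδ)
    (Eventually.of_forall fun θ => aestronglyMeasurable_exp_smul hS hG θ) ?_
    (aestronglyMeasurable_exp_smul hS (aestronglyMeasurable_smulRight hS hG) θ₀)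
    (ae_of_all _ fun y θ hθ => ?_) hbi (ae_of_all _ fun y θ _ => ?_)
  · refine (hint θ₀ hθ).mono (aestronglyMeasurable_exp_smul hS hG θ₀) (ae_of_all _ fun y => ?_)
    simp [norm_smul]
  · rw [norm_smul, ContinuousLinearMap.norm_smulRight_apply,
      Real.norm_of_nonneg (Real.exp_pos _).le]
    exact hb y θ hθ
  · have h := ((S y).hasFDerivAt (x := θ)).exp.smul_const (G y)
    convert h using 1
    ext v
    simp [mul_smul]

lemma integrable_laplace_smulRight (hU : IsOpen U)
    (hS : AEStronglyMeasurable S ν) (hG : AEStronglyMeasurable G ν)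
    (hint : ∀ θ ∈ U, Integrable (fun y => Real.exp (S y θ) * ‖G y‖) ν) {θ₀ : Θ} (hθ : θ₀ ∈ U) :
    Integrable (fun y => Real.exp (S y θ₀) * ‖(S y).smulRight (G y)‖) ν := by
  obtain ⟨δ, hδ, bound, hbi, hb⟩ :=
    exists_integrable_bound_laplace hU (fun y => norm_nonneg (G y)) hint hθ
  have hm := (aestronglyMeasurable_exp_smul hS (aestronglyMeasurable_smulRight hS hG) θ₀).norm
  refine hbi.mono' (hm.congr (ae_of_all _ fun y => ?_)) (ae_of_all _ fun y => ?_)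
  · simp [norm_smul]
  · rw [ContinuousLinearMap.norm_smulRight_apply, Real.norm_of_nonneg (by positivity)]
    exact hb y θ₀ (Metric.mem_ball_self hδ)

/-- A Laplace transform is smooth on every open set on which it converges absolutely. -/
lemma contDiffOn_laplace (hU : IsOpen U) (hS : AEStronglyMeasurable S ν)
    (hG : AEStronglyMeasurable G ν)
    (hint : ∀ θ ∈ U, Integrable (fun y => Real.exp (S y θ) * ‖G y‖) ν) (m : ℕ) :
    ContDiffOn ℝ m (laplace ν S G) U := by
  induction m generalizing F with
  | zero =>
    exact contDiffOn_zero.2 fun θ hθ =>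
      (hasFDerivAt_laplace hU hS hG hint hθ).continuousAt.continuousWithinAt
  | succ m ih =>
    have hd {θ} (hθ : θ ∈ U) := hasFDerivAt_laplace hU hS hG hint hθ
    push_cast
    rw [contDiffOn_succ_iff_fderiv_of_isOpen hU]
    refine ⟨fun θ hθ => (hd hθ).differentiableAt.differentiableWithinAt, by simp, ?_⟩
    refine (ih (aestronglyMeasurable_smulRight hS hG)
      fun θ hθ => integrable_laplace_smulRight hU hS hG hint hθ).congr fun θ hθ => (hd hθ).fderiv

end Laplace

section DirectionalDerivatives

/-! ### Directional derivatives -/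

open scoped ContDiff

variable {X Y F : Type*} [NormedAddCommGroup X] [NormedSpace ℝ X] [NormedAddCommGroup Y]
  [NormedSpace ℝ Y] [NormedAddCommGroup F] [NormedSpace ℝ F]

/-- The directional derivative of `H` along the constant vector field `v`. -/
noncomputable def pd (v : X) (H : X → F) (p : X) : F := fderiv ℝ H p v

variable {H H₁ H₂ : X → F} {O : Set X} {p v w : X}

lemma _root_.ContDiffOn.differentiableAt_of_isOpen (hH : ContDiffOn ℝ ∞ H O) (hO : IsOpen O)
    (hp : p ∈ O) : DifferentiableAt ℝ H p :=
  (hH.contDiffAt (hO.mem_nhds hp)).differentiableAt (by simp)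

lemma contDiffOn_pd (hO : IsOpen O) (hH : ContDiffOn ℝ ∞ H O) (v : X) :
    ContDiffOn ℝ ∞ (pd v H) O :=
  (hH.fderiv_of_isOpen hO (m := ∞) (by simp)).clm_apply contDiffOn_const

lemma pd_congr (hO : IsOpen O) (h : EqOn H₁ H₂ O) (hp : p ∈ O) : pd v H₁ p = pd v H₂ p := by
  rw [pd, (h.eventuallyEq_of_mem (hO.mem_nhds hp)).fderiv_eq, pd]

lemma pd_pd (hO : IsOpen O) (hH : ContDiffOn ℝ ∞ H O) (hp : p ∈ O) :
    pd v (pd w H) p = fderiv ℝ (fderiv ℝ H) p v w := by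
  have hd : DifferentiableAt ℝ (fderiv ℝ H) p :=
    (hH.fderiv_of_isOpen hO (m := ∞) (by simp)).differentiableAt_of_isOpen hO hp
  have h : HasFDerivAt (pd w H) _ p := hd.hasFDerivAt.clm_apply (hasFDerivAt_const w p)
  rw [pd, h.fderiv]
  simp

lemma pd_comm (hO : IsOpen O) (hH : ContDiffOn ℝ ∞ H O) (hp : p ∈ O) :
    pd v (pd w H) p = pd w (pd v H) p := by
  rw [pd_pd hO hH hp, pd_pd hO hH hp]
  exact ((hH.contDiffAt (hO.mem_nhds hp)).isSymmSndFDerivAt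
    (by rw [minSmoothness_of_isRCLikeNormedField]
        exact WithTop.coe_le_coe.2 (le_top : (2 : ℕ∞) ≤ ⊤))) v w

lemma hasDerivAt_line (hH : DifferentiableAt ℝ H p) (v : X) :
    HasDerivAt (fun τ : ℝ => H (p + τ • v)) (pd v H p) 0 := by
  have hl : HasDerivAt (fun τ : ℝ => p + τ • v) v 0 := by
    simpa using ((hasDerivAt_id (0 : ℝ)).smul_const v).const_add p
  have h0 : p + (0 : ℝ) • v = p := by simp
  have h1 : HasFDerivAt H (fderiv ℝ H p) (p + (0 : ℝ) • v) := by rw [h0]; exact hH.hasFDerivAt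
  exact h1.comp_hasDerivAt (0 : ℝ) hl

lemma pd_eq_of_hasDerivAt {d : F} (hH : DifferentiableAt ℝ H p)
    (h : HasDerivAt (fun τ : ℝ => H (p + τ • v)) d 0) : pd v H p = d :=
  (hasDerivAt_line hH v).unique h

lemma pd_add (h₁ : DifferentiableAt ℝ H₁ p) (h₂ : DifferentiableAt ℝ H₂ p) :
    pd v (fun q => H₁ q + H₂ q) p = pd v H₁ p + pd v H₂ p := by
  simp [pd, fderiv_fun_add h₁ h₂]

lemma pd_mul {f g : X → ℝ} (hf : DifferentiableAt ℝ f p) (hg : DifferentiableAt ℝ g p) :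
    pd v (fun q => f q * g q) p = pd v f p * g p + f p * pd v g p := by
  simp [pd, fderiv_fun_mul hf hg]; ring

lemma pd_const_mul {f : X → ℝ} (c : ℝ) (hf : DifferentiableAt ℝ f p) :
    pd v (fun q => c * f q) p = c * pd v f p := by
  simp [pd, fderiv_const_mul hf]

lemma pd_smul {f : X → ℝ} (hf : DifferentiableAt ℝ f p) (hH : DifferentiableAt ℝ H p) :
    pd v (fun q => f q • H q) p = pd v f p • H p + f p • pd v H p := by
  simp [pd, fderiv_fun_smul hf hH, add_comm]

lemma pd_sum {ι : Type*} {s : Finset ι} {f : ι → X → F} (hf : ∀ i ∈ s, DifferentiableAt ℝ (f i) p) :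
    pd v (fun q => ∑ i ∈ s, f i q) p = ∑ i ∈ s, pd v (f i) p := by
  simp [pd, fderiv_fun_sum hf]

lemma pd_comp {G : X → Y} {h : Y → F} (hh : DifferentiableAt ℝ h (G p))
    (hG : DifferentiableAt ℝ G p) : pd v (fun q => h (G q)) p = pd (pd v G p) h (G p) := by
  have := fderiv_comp p hh hG
  simp only [Function.comp_def] at this
  simp [pd, this]

end DirectionalDerivatives

section HeatEquation

/-! ### The heat semigroup on functions of Gaussian growth -/

open scoped ContDiff RealInnerProductSpace

variable {n : ℕ}

/-- The statistic `(a, b) ↦ -a ‖y‖² + ⟪y, b⟫`, whose exponentials are the Gaussian kernels up to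
normalization. -/
noncomputable def gaussStat (y : Vec n) : ℝ × Vec n →L[ℝ] ℝ :=
  (-‖y‖ ^ 2) • ContinuousLinearMap.fst ℝ ℝ (Vec n) +
    (innerSL ℝ y).comp (ContinuousLinearMap.snd ℝ ℝ (Vec n))

lemma gaussStat_apply (y : Vec n) (p : ℝ × Vec n) :
    gaussStat y p = -p.1 * ‖y‖ ^ 2 + ⟪y, p.2⟫ := by
  simp [gaussStat]; ring

lemma continuous_gaussStat : Continuous (gaussStat (n := n)) := by
  unfold gaussStat; fun_prop

/-- The function `f` is measurable and grows at most like `exp (κ ‖y‖² / 2)`, in the sense that it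
is integrable against all more concentrated Gaussian kernels. -/
structure GaussGrowth (κ : ℝ) (f : Vec n → ℝ) : Prop where
  measurable : AEStronglyMeasurable f volume
  integrable : ∀ a b, κ / 2 < a → Integrable fun y => Real.exp (-a * ‖y‖ ^ 2 + b * ‖y‖) * ‖f y‖

variable {κ : ℝ} {f : Vec n → ℝ}

/-- The heat semigroup, `u(s, x) = 𝔼 f(x + √s Z)` for a standard Gaussian vector `Z`. -/
noncomputable def heat (f : Vec n → ℝ) (p : ℝ × Vec n) : ℝ :=
  ∫ w, f (p.2 + √p.1 • w) ∂(stdGaussian (Vec n))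

/-- The time-space domain on which the heat semigroup is applied. -/
def heatDomain (n : ℕ) (κ : ℝ) : Set (ℝ × Vec n) := {p | 0 < p.1 ∧ κ * p.1 < 1}

lemma isOpen_heatDomain : IsOpen (heatDomain n κ) :=
  (isOpen_lt continuous_const continuous_fst).inter
    (isOpen_lt (by fun_prop : Continuous fun p : ℝ × Vec n => κ * p.1) continuous_const)

lemma isOpen_gaussDomain : IsOpen {p : ℝ × Vec n | κ / 2 < p.1} :=
  isOpen_lt continuous_const continuous_fst

/-- The Laplace transform of `f` along the Gaussian statistic. -/
noncomputable def gaussLaplace (f : Vec n → ℝ) : ℝ × Vec n → ℝ := laplace volume gaussStat f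

/-- The Gaussian factor relating the heat semigroup to a Laplace transform. -/
noncomputable def heatFactor (p : ℝ × Vec n) : ℝ :=
  gaussConst n * p.1 ^ (-(n : ℝ) / 2) * Real.exp (-‖p.2‖ ^ 2 / (2 * p.1))

/-- The parameters of the Laplace transform that computes the heat semigroup at `(s, x)`. -/
noncomputable def heatParam (p : ℝ × Vec n) : ℝ × Vec n := (1 / (2 * p.1), p.1⁻¹ • p.2)

lemma heat_eq_mul_gaussLaplace {p : ℝ × Vec n} (hp : 0 < p.1) :
    heat f p = heatFactor p * gaussLaplace f (heatParam p) := by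
  obtain ⟨s, x⟩ := p
  simp only at hp
  have hs : 0 < √s := Real.sqrt_pos.2 hp
  have hss : √s ^ 2 = s := Real.sq_sqrt hp.le
  simp only [heat, heatFactor, gaussLaplace, laplace, heatParam]
  rw [integral_stdGaussian]
  have h1 : ∀ w : Vec n, Real.exp (-(1 / 2) * ‖w‖ ^ 2) * f (x + √s • w) =
      (fun y => Real.exp (-(1 / 2) * ‖(√s)⁻¹ • y‖ ^ 2) * f (x + y)) (√s • w) := by
    intro w
    simp only
    rw [smul_smul, inv_mul_cancel₀ hs.ne', one_smul]
  rw [integral_congr_ae (ae_of_all _ h1), Measure.integral_comp_smul volume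
      (fun y => Real.exp (-(1 / 2) * ‖(√s)⁻¹ • y‖ ^ 2) * f (x + y)),
    ← integral_sub_right_eq_self (fun y => Real.exp (-(1 / 2) * ‖(√s)⁻¹ • y‖ ^ 2) * f (x + y)) x]
  have h2 : ∀ y : Vec n, Real.exp (-(1 / 2) * ‖(√s)⁻¹ • (y - x)‖ ^ 2) * f (x + (y - x)) =
      Real.exp (-‖x‖ ^ 2 / (2 * s)) * (Real.exp (gaussStat y (1 / (2 * s), s⁻¹ • x)) • f y) := by
    intro y
    rw [add_sub_cancel, gaussStat_apply, smul_eq_mul, ← mul_assoc, ← Real.exp_add, norm_smul,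
      mul_pow, norm_sub_sq_real, Real.norm_of_nonneg (by positivity), inv_pow, hss,
      inner_smul_right]
    congr 2
    field_simp
    ring
  simp_rw [h2]
  rw [integral_const_mul, finrank_euclideanSpace, Fintype.card_fin, smul_eq_mul]
  have h3 : |(√s ^ n)⁻¹| = s ^ (-(n : ℝ) / 2) := by
    rw [abs_of_pos (by positivity), Real.sqrt_eq_rpow, ← Real.rpow_natCast, ← Real.rpow_mul hp.le,
      ← Real.rpow_neg hp.le]
    congr 1; ring
  rw [h3]; ring

lemma mapsTo_heatParam : MapsTo heatParam (heatDomain n κ) {p | κ / 2 < p.1} := by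
  rintro ⟨s, x⟩ ⟨h1, h2⟩
  simp only [heatParam, mem_ofPred_eq] at *
  rw [lt_div_iff₀ (by positivity)]; linarith

lemma GaussGrowth.integrable_gaussStat (hf : GaussGrowth κ f) :
    ∀ θ ∈ {p : ℝ × Vec n | κ / 2 < p.1},
      Integrable (fun y => Real.exp (gaussStat y θ) * ‖f y‖) volume := by
  intro θ hθ
  have hm : AEStronglyMeasurable (fun y : Vec n => Real.exp (gaussStat y θ)) volume :=
    (Real.continuous_exp.comp ((ContinuousLinearMap.apply ℝ ℝ θ).continuous.comp
      continuous_gaussStat)).aestronglyMeasurable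
  refine (hf.integrable θ.1 ‖θ.2‖ hθ).mono' (hm.mul hf.measurable.norm)
    (ae_of_all _ fun y => ?_)
  rw [Real.norm_of_nonneg (by positivity), gaussStat_apply]
  gcongr
  rw [mul_comm]; exact real_inner_le_norm y θ.2

lemma contDiffOn_gaussLaplace (hf : GaussGrowth κ f) :
    ContDiffOn ℝ ∞ (gaussLaplace f) {p | κ / 2 < p.1} :=
  contDiffOn_infty.2 fun m => contDiffOn_laplace isOpen_gaussDomain
    continuous_gaussStat.aestronglyMeasurable hf.measurable hf.integrable_gaussStat m

lemma contDiffOn_heatParam : ContDiffOn ℝ ∞ heatParam (heatDomain n κ) := by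
  have h (p) (hp : p ∈ heatDomain n κ) : p.1 ≠ 0 := hp.1.ne'
  refine ContDiffOn.prodMk (ContDiffOn.div contDiffOn_const (by fun_prop) ?_)
    ((contDiffOn_fst.inv h).smul contDiffOn_snd)
  intro p hp
  exact mul_ne_zero two_ne_zero (h p hp)

lemma contDiffOn_heatFactor : ContDiffOn ℝ ∞ heatFactor (heatDomain n κ) := by
  have h (p) (hp : p ∈ heatDomain n κ) : p.1 ≠ 0 := hp.1.ne'
  refine (contDiffOn_const.mul (contDiffOn_fst.rpow_const_of_ne h)).mul
    (ContDiffOn.exp (ContDiffOn.div ?_ (by fun_prop) ?_))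
  · exact ((contDiff_norm_sq ℝ).comp contDiff_snd).neg.contDiffOn
  · intro p hp
    exact mul_ne_zero two_ne_zero (h p hp)

/-- The heat semigroup is smooth in time and space. -/
lemma contDiffOn_heat (hf : GaussGrowth κ f) : ContDiffOn ℝ ∞ (heat f) (heatDomain n κ) :=
  (contDiffOn_heatFactor.mul ((contDiffOn_gaussLaplace hf).comp contDiffOn_heatParam
    mapsTo_heatParam)).congr fun _ hp => heat_eq_mul_gaussLaplace hp.1

/-- Directional derivatives of a Laplace transform are again Laplace transforms, of functions to
which the same statement applies. -/
lemma pd_laplace {α : Type*} [MeasurableSpace α] {ν : Measure α} {Θ : Type}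
    [NormedAddCommGroup Θ] [NormedSpace ℝ Θ] [FiniteDimensional ℝ Θ] {S : α → Θ →L[ℝ] ℝ}
    {G : α → ℝ} {U : Set Θ} (hU : IsOpen U) (hS : AEStronglyMeasurable S ν)
    (hG : AEStronglyMeasurable G ν)
    (hint : ∀ θ ∈ U, Integrable (fun y => Real.exp (S y θ) * ‖G y‖) ν) (v : Θ) :
    (∀ θ ∈ U, pd v (laplace ν S G) θ = laplace ν S (fun y => S y v * G y) θ) ∧
      (∀ θ ∈ U, Integrable (fun y => Real.exp (S y θ) * ‖S y v * G y‖) ν) ∧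
      AEStronglyMeasurable (fun y => S y v * G y) ν := by
  have hSv : AEStronglyMeasurable (fun y => S y v * G y) ν :=
    ((ContinuousLinearMap.apply ℝ ℝ v).continuous.comp_aestronglyMeasurable hS).mul hG
  refine ⟨fun θ hθ => ?_, fun θ hθ => ?_, hSv⟩
  · have hi := integrable_laplace_smulRight hU hS hG hint hθ
    rw [pd, (hasFDerivAt_laplace hU hS hG hint hθ).fderiv, laplace, laplace,
      ContinuousLinearMap.integral_apply]
    · simp
    · refine hi.mono (aestronglyMeasurable_exp_smul hS (aestronglyMeasurable_smulRight hS hG) θ)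
        (ae_of_all _ fun y => ?_)
      simp [norm_smul]
  · have hi := (integrable_laplace_smulRight hU hS hG hint hθ).mul_const ‖v‖
    have hm := (aestronglyMeasurable_exp_smul hS hSv θ).norm
    refine hi.mono' (hm.congr (ae_of_all _ fun y => by simp)) (ae_of_all _ fun y => ?_)
    rw [ContinuousLinearMap.norm_smulRight_apply, Real.norm_of_nonneg (by positivity), norm_mul]
    have := (S y).le_opNorm v
    calc _ ≤ Real.exp (S y θ) * ((‖S y‖ * ‖v‖) * ‖G y‖) := by gcongr
      _ = _ := by ring

/-- The `i`-th coordinate direction of space, in time-space. -/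
noncomputable def dirX (i : Fin n) : ℝ × Vec n := (0, EuclideanSpace.single i 1)

/-- Gaussian Laplace transforms satisfy `∂M/∂a = -∑ᵢ ∂²M/∂bᵢ²`, because the statistic attached to
`a` is minus the sum of the squares of the statistics attached to the `bᵢ`. -/
lemma pd_gaussLaplace (hf : GaussGrowth κ f) {p : ℝ × Vec n} (hp : κ / 2 < p.1) :
    pd (1, 0) (gaussLaplace f) p = -∑ i, pd (dirX i) (pd (dirX i) (gaussLaplace f)) p := by
  have hS := (continuous_gaussStat (n := n)).aestronglyMeasurable (μ := volume)
  have h1 (v) := pd_laplace isOpen_gaussDomain hS hf.measurable hf.integrable_gaussStat v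
  have h2 (v) := pd_laplace isOpen_gaussDomain hS (h1 v).2.2 (h1 v).2.1 v
  have h3 (i : Fin n) : pd (dirX i) (pd (dirX i) (gaussLaplace f)) p =
      ∫ y, Real.exp (gaussStat y p) • (gaussStat y (dirX i) * (gaussStat y (dirX i) * f y)) := by
    unfold gaussLaplace
    rw [pd_congr isOpen_gaussDomain (h1 (dirX i)).1 hp, (h2 (dirX i)).1 p hp, laplace]
  simp_rw [h3]
  rw [gaussLaplace, (h1 _).1 p hp, laplace, ← integral_finsetSum, ← integral_neg]
  · congr 1
    ext y
    have h4 (i : Fin n) : gaussStat y (dirX i) = y i := by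
      simp [gaussStat_apply, dirX, EuclideanSpace.inner_single_right]
    have h5 : gaussStat y ((1 : ℝ), (0 : Vec n)) = -∑ i, y i ^ 2 := by
      rw [gaussStat_apply, EuclideanSpace.real_norm_sq_eq]; simp
    simp_rw [h4, h5, smul_eq_mul]
    rw [neg_mul, mul_neg, Finset.sum_mul, Finset.mul_sum]
    congr 1
    exact Finset.sum_congr rfl fun i _ => by ring
  · intro i _
    refine ((h2 (dirX i)).2.1 p hp).mono (aestronglyMeasurable_exp_smul hS (h2 _).2.2 p)
      (ae_of_all _ fun y => ?_)
    simp

lemma hasDerivAt_heatFactor_dirX {p : ℝ × Vec n} (i : Fin n) :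
    HasDerivAt (fun τ : ℝ => heatFactor (p + τ • dirX i))
      (-(p.2 i / p.1) * heatFactor p) 0 := by
  have h : ∀ τ : ℝ, heatFactor (p + τ • dirX i) = gaussConst n * p.1 ^ (-(n : ℝ) / 2) *
      Real.exp (-(‖p.2‖ ^ 2 + 2 * (τ * p.2 i) + τ ^ 2) / (2 * p.1)) := by
    intro τ
    have : ‖p.2 + τ • EuclideanSpace.single i (1 : ℝ)‖ ^ 2 =
        ‖p.2‖ ^ 2 + 2 * (τ * p.2 i) + τ ^ 2 := by
      rw [norm_add_sq_real, inner_smul_right, EuclideanSpace.inner_single_right, norm_smul]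
      simp
    simp [heatFactor, dirX, this]
  simp_rw [h]
  have h1 : HasDerivAt (fun τ : ℝ => -(‖p.2‖ ^ 2 + 2 * (τ * p.2 i) + τ ^ 2) / (2 * p.1))
      (-(p.2 i / p.1)) 0 := by
    have := (((((hasDerivAt_id (0 : ℝ)).mul_const (p.2 i)).const_mul 2).const_add
      (‖p.2‖ ^ 2)).fun_add ((hasDerivAt_id (0 : ℝ)).fun_pow 2)).fun_neg.div_const (2 * p.1)
    refine this.congr_deriv ?_
    simp only [id, one_mul, Nat.cast_ofNat, mul_one]
    ring
  refine (h1.exp.const_mul (gaussConst n * p.1 ^ (-(n : ℝ) / 2))).congr_deriv ?_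
  simp only [heatFactor, zero_mul, mul_zero, add_zero, ne_eq, OfNat.ofNat_ne_zero,
    not_false_eq_true, zero_pow]
  ring

lemma hasDerivAt_heatFactor_time {p : ℝ × Vec n} (hp : 0 < p.1) :
    HasDerivAt (fun τ : ℝ => heatFactor (p + τ • ((1 : ℝ), (0 : Vec n))))
      ((-n / (2 * p.1) + ‖p.2‖ ^ 2 / (2 * p.1 ^ 2)) * heatFactor p) 0 := by
  have h : ∀ τ : ℝ, heatFactor (p + τ • ((1 : ℝ), (0 : Vec n))) =
      gaussConst n * (p.1 + τ) ^ (-(n : ℝ) / 2) * Real.exp (-‖p.2‖ ^ 2 / (2 * (p.1 + τ))) := by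
    intro τ; simp [heatFactor]
  simp_rw [h]
  have h0 : HasDerivAt (fun τ : ℝ => p.1 + τ) 1 0 := (hasDerivAt_id (0 : ℝ)).const_add p.1
  have hne : p.1 + 0 ≠ 0 := by rw [add_zero]; exact hp.ne'
  have h1 := (h0.rpow_const (p := -(n : ℝ) / 2) (Or.inl hne)).const_mul (gaussConst n)
  have h2 := ((hasDerivAt_const (0 : ℝ) (-‖p.2‖ ^ 2)).fun_div (h0.const_mul 2)
    (mul_ne_zero two_ne_zero hne)).exp
  refine (h1.fun_mul h2).congr_deriv ?_
  simp only [heatFactor, add_zero]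
  rw [Real.rpow_sub_one hp.ne']
  field_simp
  ring

lemma hasDerivAt_heatParam_dirX {p : ℝ × Vec n} (i : Fin n) :
    HasDerivAt (fun τ : ℝ => heatParam (p + τ • dirX i)) (p.1⁻¹ • dirX i) 0 := by
  have h : ∀ τ : ℝ, heatParam (p + τ • dirX i) = heatParam p + τ • (p.1⁻¹ • dirX i) := by
    intro τ
    simp only [heatParam, dirX, Prod.fst_add, Prod.snd_add, Prod.smul_mk, smul_zero, add_zero,
      smul_add, Prod.mk_add_mk, smul_comm p.1⁻¹ τ]
  simp_rw [h]
  simpa using ((hasDerivAt_id (0 : ℝ)).smul_const (p.1⁻¹ • dirX i)).const_add (heatParam p)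

lemma hasDerivAt_heatParam_time {p : ℝ × Vec n} (hp : 0 < p.1) :
    HasDerivAt (fun τ : ℝ => heatParam (p + τ • ((1 : ℝ), (0 : Vec n))))
      (-(1 / (2 * p.1 ^ 2)) • ((1 : ℝ), (0 : Vec n)) -
        (1 / p.1 ^ 2) • ∑ i, p.2 i • dirX i) 0 := by
  have h : ∀ τ : ℝ, heatParam (p + τ • ((1 : ℝ), (0 : Vec n))) =
      ((1 / 2) * (p.1 + τ)⁻¹, (p.1 + τ)⁻¹ • p.2) := by
    intro τ; simp [heatParam]; ring
  simp_rw [h]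
  have h0 : HasDerivAt (fun τ : ℝ => p.1 + τ) 1 0 := (hasDerivAt_id (0 : ℝ)).const_add p.1
  have hne : p.1 + 0 ≠ 0 := by rw [add_zero]; exact hp.ne'
  have h1 := h0.fun_inv hne
  refine ((h1.const_mul (1 / 2)).prodMk (h1.smul_const p.2)).congr_deriv ?_
  have hx : (∑ i, p.2 i • dirX i : ℝ × Vec n) = (0, p.2) := by
    ext j
    · simp [dirX, Prod.fst_sum]
    · simp [dirX, Prod.snd_sum, Pi.single_apply]
  rw [hx]
  ext j
  · simp; ring
  · simp; ring

/-- The heat equation. -/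
lemma pd_heat (hf : GaussGrowth κ f) {p : ℝ × Vec n} (hp : p ∈ heatDomain n κ) :
    pd (1, 0) (heat f) p = 1 / 2 * ∑ i, pd (dirX i) (pd (dirX i) (heat f)) p := by
  have hM := contDiffOn_gaussLaplace hf
  have hMi (i : Fin n) := contDiffOn_pd isOpen_gaussDomain hM (dirX i)
  have hu := contDiffOn_heat hf
  -- the chain rule for a function of the parameters of the Laplace transform
  have hline {m : ℝ × Vec n → ℝ} (hm : ContDiffOn ℝ ∞ m {p | κ / 2 < p.1}) {q : ℝ × Vec n}
      (hq : q ∈ heatDomain n κ) {d v : ℝ × Vec n}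
      (hd : HasDerivAt (fun τ : ℝ => heatParam (q + τ • v)) d 0) :
      HasDerivAt (fun τ : ℝ => m (heatParam (q + τ • v))) (pd d m (heatParam q)) 0 := by
    have h0 : heatParam q = heatParam (q + (0 : ℝ) • v) := by simp
    have h1 := (hm.differentiableAt_of_isOpen isOpen_gaussDomain (mapsTo_heatParam hq)).hasFDerivAt
    rw [h0] at h1
    have := h1.comp_hasDerivAt (0 : ℝ) hd
    rw [← h0] at this
    exact this
  have hnear {q : ℝ × Vec n} (hq : q ∈ heatDomain n κ) (v : ℝ × Vec n) :
      ∀ᶠ τ : ℝ in 𝓝 0, q + τ • v ∈ heatDomain n κ := by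
    have : ContinuousAt (fun τ : ℝ => q + τ • v) 0 := by fun_prop
    exact this.eventually_mem (isOpen_heatDomain.mem_nhds (by simpa using hq))
  have hfirst (i : Fin n) : EqOn (pd (dirX i) (heat f)) (fun q => heatFactor q * (q.1⁻¹ *
      (pd (dirX i) (gaussLaplace f) (heatParam q) - q.2 i * gaussLaplace f (heatParam q))))
      (heatDomain n κ) := by
    intro q hq
    refine pd_eq_of_hasDerivAt (hu.differentiableAt_of_isOpen isOpen_heatDomain hq) ?_
    have h1 := (hasDerivAt_heatFactor_dirX (p := q) i).fun_mul
      (hline hM hq (hasDerivAt_heatParam_dirX i))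
    refine (h1.congr_of_eventuallyEq ?_).congr_deriv ?_
    · filter_upwards [hnear hq (dirX i)] with τ hτ
      exact heat_eq_mul_gaussLaplace hτ.1
    · simp only [pd, map_smul, zero_smul, add_zero, smul_eq_mul]
      ring
  have hsecond (i : Fin n) : pd (dirX i) (pd (dirX i) (heat f)) p =
      heatFactor p * (p.1⁻¹ ^ 2 * (pd (dirX i) (pd (dirX i) (gaussLaplace f)) (heatParam p)
        - 2 * p.2 i * pd (dirX i) (gaussLaplace f) (heatParam p) +
        (p.2 i ^ 2 - p.1) * gaussLaplace f (heatParam p))) := by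
    refine pd_eq_of_hasDerivAt ((contDiffOn_pd isOpen_heatDomain hu _).differentiableAt_of_isOpen
      isOpen_heatDomain hp) ?_
    have hx : HasDerivAt (fun τ : ℝ => p.2 i + τ) 1 0 := (hasDerivAt_id (0 : ℝ)).const_add _
    have h1 := (hasDerivAt_heatFactor_dirX (p := p) i).fun_mul
      (((hline (hMi i) hp (hasDerivAt_heatParam_dirX i)).fun_sub
        (hx.fun_mul (hline hM hp (hasDerivAt_heatParam_dirX i)))).const_mul p.1⁻¹)
    refine (h1.congr_of_eventuallyEq ?_).congr_deriv ?_
    · filter_upwards [hnear hp (dirX i)] with τ hτ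
      rw [hfirst i hτ]
      simp [dirX]
    · have := hp.1.ne'
      simp only [pd, map_smul, zero_smul, add_zero, smul_eq_mul]
      field_simp
      ring
  have htime : pd (1, 0) (heat f) p = heatFactor p *
      ((-n / (2 * p.1) + ‖p.2‖ ^ 2 / (2 * p.1 ^ 2)) * gaussLaplace f (heatParam p) -
        1 / (2 * p.1 ^ 2) * pd (1, 0) (gaussLaplace f) (heatParam p) -
        1 / p.1 ^ 2 * ∑ i, p.2 i * pd (dirX i) (gaussLaplace f) (heatParam p)) := by
    refine pd_eq_of_hasDerivAt (hu.differentiableAt_of_isOpen isOpen_heatDomain hp) ?_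
    have h1 := (hasDerivAt_heatFactor_time hp.1).fun_mul
      (hline hM hp (hasDerivAt_heatParam_time hp.1))
    refine (h1.congr_of_eventuallyEq ?_).congr_deriv ?_
    · filter_upwards [hnear hp (1, 0)] with τ hτ
      exact heat_eq_mul_gaussLaplace hτ.1
    · simp only [pd, map_smul, map_sub, map_sum, zero_smul, add_zero, smul_eq_mul]
      ring
  rw [htime, pd_gaussLaplace hf (mapsTo_heatParam hp)]
  simp_rw [hsecond]
  rw [← Finset.mul_sum, ← Finset.mul_sum, Finset.sum_add_distrib, Finset.sum_sub_distrib,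
    ← Finset.sum_mul, Finset.sum_sub_distrib, EuclideanSpace.real_norm_sq_eq]
  have h3 : ∑ i, 2 * p.2 i * pd (dirX i) (gaussLaplace f) (heatParam p) =
      2 * ∑ i, p.2 i * pd (dirX i) (gaussLaplace f) (heatParam p) := by
    rw [Finset.mul_sum]; exact Finset.sum_congr rfl fun i _ => by ring
  have := hp.1.ne'
  rw [h3]
  simp only [Finset.sum_const, Finset.card_univ, Fintype.card_fin, nsmul_eq_mul]
  field_simp
  ring

end HeatEquation

section BackwardOperator

/-! ### The backward heat operator and the change of variables -/

open scoped ContDiff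

variable {n : ℕ} {F : Type*} [NormedAddCommGroup F] [NormedSpace ℝ F]
  {σ : Matrix (Fin n) (Fin n) ℝ} {γ T : ℝ} {D : Set (ℝ × Vec n)}

/-- The spatial direction given by the `i`-th column of `σ`, in time-space. -/
noncomputable def dirS (σ : Matrix (Fin n) (Fin n) ℝ) (i : Fin n) : ℝ × Vec n :=
  (0, act σ (EuclideanSpace.single i 1))

/-- The backward heat operator `∂ₜ + ½ ∑ᵢ ∂²` with second derivatives along the columns of `σ`. -/
noncomputable def heatOp (σ : Matrix (Fin n) (Fin n) ℝ) (H : ℝ × Vec n → F) (p : ℝ × Vec n) : F :=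
  pd (1, 0) H p + (1 / 2 : ℝ) • ∑ i, pd (dirS σ i) (pd (dirS σ i) H) p

/-- The Hopf–Cole transform: if `exp (γ W)` solves the backward heat equation, then `W` solves the
backward equation with quadratic gradient term. -/
lemma heatOp_of_exp {W U : ℝ × Vec n → ℝ} (hD : IsOpen D) (hW : ContDiffOn ℝ ∞ W D) (hγ : γ ≠ 0)
    (hU : ∀ p ∈ D, U p = Real.exp (γ * W p)) (hheat : ∀ p ∈ D, heatOp σ U p = 0)
    {p : ℝ × Vec n} (hp : p ∈ D) :
    heatOp σ W p = -(γ / 2) * ∑ i, pd (dirS σ i) W p ^ 2 := by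
  have hWd {q} (hq : q ∈ D) := hW.differentiableAt_of_isOpen hD hq
  have h1 (v : ℝ × Vec n) : EqOn (pd v U) (fun q => γ * pd v W q * U q) D := by
    intro q hq
    rw [pd_congr hD hU hq]
    have h := ((hWd hq).hasFDerivAt.const_mul γ).exp
    simp only [pd]
    rw [h.fderiv, hU q hq]
    simp; ring
  have hUd : ContDiffOn ℝ ∞ U D := ((contDiffOn_const.mul hW).exp).congr hU
  have h2 (v : ℝ × Vec n) : pd v (pd v U) p = γ * U p * (pd v (pd v W) p + γ * pd v W p ^ 2) := by
    have hv := (contDiffOn_pd hD hW v).differentiableAt_of_isOpen hD hp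
    rw [pd_congr hD (h1 v) hp, pd_mul (hv.const_mul γ) (hUd.differentiableAt_of_isOpen hD hp),
      pd_const_mul _ hv, h1 v hp]
    ring
  have h3 := hheat p hp
  simp only [heatOp, smul_eq_mul] at h3 ⊢
  simp_rw [h2] at h3
  rw [h1 _ hp, ← Finset.mul_sum, Finset.sum_add_distrib, ← Finset.mul_sum] at h3
  have hUp : γ * U p ≠ 0 := mul_ne_zero hγ (by rw [hU p hp]; exact (Real.exp_pos _).ne')
  have h4 : γ * U p * (pd (1, 0) W p + 1 / 2 * ∑ i, pd (dirS σ i) (pd (dirS σ i) W) p +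
      γ / 2 * ∑ i, pd (dirS σ i) W p ^ 2) = 0 := by linear_combination h3
  have := (mul_eq_zero.1 h4).resolve_left hUp
  linarith

/-- `W` is a smooth solution on `D` of the backward equation with quadratic gradient term. -/
structure IsBurgersPotential (σ : Matrix (Fin n) (Fin n) ℝ) (γ : ℝ) (D : Set (ℝ × Vec n))
    (W : ℝ × Vec n → ℝ) : Prop where
  isOpen : IsOpen D
  contDiffOn : ContDiffOn ℝ ∞ W D
  heatOp_eq : ∀ p ∈ D, heatOp σ W p = -(γ / 2) * ∑ i, pd (dirS σ i) W p ^ 2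

variable {W : ℝ × Vec n → ℝ}

/-- The derivatives of a potential are transported: they solve the linearized equation. -/
lemma IsBurgersPotential.heatOp_pd (h : IsBurgersPotential σ γ D W) (v : ℝ × Vec n)
    {p : ℝ × Vec n} (hp : p ∈ D) :
    heatOp σ (pd v W) p = -γ * ∑ i, pd (dirS σ i) W p * pd (dirS σ i) (pd v W) p := by
  have hD := h.isOpen
  have h1 (w) := contDiffOn_pd hD h.contDiffOn w
  have h2 (w w') := contDiffOn_pd hD (h1 w) w'
  have d1 (w) := (h1 w).differentiableAt_of_isOpen hD hp
  have d2 (w w') := (h2 w w').differentiableAt_of_isOpen hD hp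
  have hcomm (w w') : EqOn (pd w (pd w' W)) (pd w' (pd w W)) D :=
    fun q hq => pd_comm hD h.contDiffOn hq
  have hL : pd v (heatOp σ W) p = heatOp σ (pd v W) p := by
    have : heatOp σ W = fun q => pd (1, 0) W q +
        (1 / 2 : ℝ) * ∑ i, pd (dirS σ i) (pd (dirS σ i) W) q := rfl
    rw [this, pd_add (d1 _) ((DifferentiableAt.fun_sum fun i _ => d2 _ _).const_mul _),
      pd_const_mul _ (DifferentiableAt.fun_sum fun i _ => d2 _ _), pd_sum fun i _ => d2 _ _,
      heatOp, smul_eq_mul, hcomm v _ hp]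
    congr 2
    refine Finset.sum_congr rfl fun i _ => ?_
    rw [pd_comm hD (h1 _) hp, pd_congr hD (hcomm v _) hp]
  rw [← hL, pd_congr hD h.heatOp_eq hp]
  have hsq : ∀ q, -(γ / 2) * ∑ i, pd (dirS σ i) W q ^ 2 =
      -(γ / 2) * ∑ i, pd (dirS σ i) W q * pd (dirS σ i) W q := by
    intro q; simp_rw [sq]
  simp_rw [hsq]
  rw [pd_const_mul _ (DifferentiableAt.fun_sum fun i _ => (d1 _).fun_mul (d1 _)),
    pd_sum fun i _ => (d1 _).fun_mul (d1 _), Finset.mul_sum, Finset.mul_sum]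
  refine Finset.sum_congr rfl fun i _ => ?_
  rw [pd_mul (d1 _) (d1 _), hcomm v _ hp]
  ring

/-- The image `σ (σᵀ ∇W)` of the gradient of `W` in space, for symmetric `σ`. -/
noncomputable def drift (σ : Matrix (Fin n) (Fin n) ℝ) (W : ℝ × Vec n → ℝ) (p : ℝ × Vec n) :
    Vec n :=
  ∑ i, pd (dirS σ i) W p • act σ (EuclideanSpace.single i 1)

/-- The inverse `Ψ(t, ·)` of the optimal map, `Ψ(t,z) = z + γ (T - t) σ² ∇W(t,z)`. -/
noncomputable def invMap (σ : Matrix (Fin n) (Fin n) ℝ) (γ T : ℝ) (W : ℝ × Vec n → ℝ)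
    (p : ℝ × Vec n) : Vec n :=
  p.2 + (γ * (T - p.1)) • drift σ W p

lemma IsBurgersPotential.contDiffOn_drift (h : IsBurgersPotential σ γ D W) :
    ContDiffOn ℝ ∞ (drift σ W) D :=
  ContDiffOn.sum fun _ _ => (contDiffOn_pd h.isOpen h.contDiffOn _).smul contDiffOn_const

lemma IsBurgersPotential.contDiffOn_invMap (h : IsBurgersPotential σ γ D W) :
    ContDiffOn ℝ ∞ (invMap σ γ T W) D :=
  contDiffOn_snd.add (ContDiffOn.smul
    (by fun_prop : ContDiff ℝ ∞ fun q : ℝ × Vec n => γ * (T - q.1)).contDiffOn h.contDiffOn_drift)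

lemma pd_snd (v p : ℝ × Vec n) : pd v (fun q : ℝ × Vec n => q.2) p = v.2 := by
  simp [pd, (hasFDerivAt_snd (p := p) (𝕜 := ℝ)).fderiv]

lemma pd_scale (v p : ℝ × Vec n) :
    pd v (fun q : ℝ × Vec n => γ * (T - q.1)) p = -(γ * v.1) := by
  have : HasFDerivAt (fun q : ℝ × Vec n => γ * (T - q.1))
      (γ • -ContinuousLinearMap.fst ℝ ℝ (Vec n)) p := (hasFDerivAt_fst.const_sub T).const_mul γ
  simp [pd, this.fderiv]

lemma IsBurgersPotential.pd_invMap (h : IsBurgersPotential σ γ D W) (v : ℝ × Vec n)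
    {p : ℝ × Vec n} (hp : p ∈ D) :
    pd v (invMap σ γ T W) p =
      v.2 + (-(γ * v.1)) • drift σ W p + (γ * (T - p.1)) • pd v (drift σ W) p := by
  have hd := h.contDiffOn_drift.differentiableAt_of_isOpen h.isOpen hp
  have hc : DifferentiableAt ℝ (fun q : ℝ × Vec n => γ * (T - q.1)) p := by fun_prop
  have : invMap σ γ T W = fun q => q.2 + (fun q : ℝ × Vec n => γ * (T - q.1)) q • drift σ W q := rfl
  rw [this, pd_add (by fun_prop) (hc.fun_smul hd), pd_smul hc hd, pd_snd, pd_scale, add_assoc]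

/-- The inverse map is transported by the drift of the potential. -/
lemma IsBurgersPotential.heatOp_invMap (h : IsBurgersPotential σ γ D W)
    {p : ℝ × Vec n} (hp : p ∈ D) :
    heatOp σ (invMap σ γ T W) p =
      -γ • ∑ i, pd (dirS σ i) W p • pd (dirS σ i) (invMap σ γ T W) p := by
  have hD := h.isOpen
  have hdr := h.contDiffOn_drift
  have d1 (w) {q} (hq : q ∈ D) := (contDiffOn_pd hD h.contDiffOn w).differentiableAt_of_isOpen hD hq
  have d2 (w w') {q} (hq : q ∈ D) :=
    (contDiffOn_pd hD (contDiffOn_pd hD h.contDiffOn w) w').differentiableAt_of_isOpen hD hq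
  have hpd (v) : EqOn (pd v (drift σ W))
      (fun q => ∑ i, pd v (pd (dirS σ i) W) q • act σ (EuclideanSpace.single i 1)) D := by
    intro q hq
    unfold drift
    rw [pd_sum fun i _ => (d1 _ hq).smul_const _]
    refine Finset.sum_congr rfl fun i _ => ?_
    rw [pd_smul (d1 _ hq) (differentiableAt_const _)]
    simp [pd]
  have hpd2 (v) : pd v (pd v (drift σ W)) p =
      ∑ i, pd v (pd v (pd (dirS σ i) W)) p • act σ (EuclideanSpace.single i 1) := by
    rw [pd_congr hD (hpd v) hp, pd_sum fun i _ => (d2 _ _ hp).smul_const _]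
    refine Finset.sum_congr rfl fun i _ => ?_
    rw [pd_smul (d2 _ _ hp) (differentiableAt_const _)]
    simp [pd]
  -- the drift has the derivatives of `W` as coefficients, which solve the linearized equation
  have hop : heatOp σ (drift σ W) p =
      -γ • ∑ i, pd (dirS σ i) W p • pd (dirS σ i) (drift σ W) p := by
    have e1 : heatOp σ (drift σ W) p =
        ∑ j, heatOp σ (pd (dirS σ j) W) p • act σ (EuclideanSpace.single j 1) := by
      simp only [heatOp, hpd2, hpd _ hp, smul_eq_mul, add_smul, Finset.sum_add_distrib]
      congr 1
      rw [Finset.sum_comm, Finset.smul_sum]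
      refine Finset.sum_congr rfl fun j _ => ?_
      rw [← Finset.sum_smul, smul_smul]
    rw [e1]
    simp only [h.heatOp_pd _ hp, hpd _ hp]
    simp_rw [Finset.smul_sum (r := pd _ W p), Finset.mul_sum, Finset.sum_smul]
    rw [Finset.sum_comm, Finset.smul_sum]
    refine Finset.sum_congr rfl fun i _ => ?_
    rw [Finset.smul_sum]
    refine Finset.sum_congr rfl fun j _ => ?_
    simp only [smul_smul]
  have hs (i : Fin n) : EqOn (pd (dirS σ i) (invMap σ γ T W))
      (fun q => act σ (EuclideanSpace.single i 1) +
        (fun q : ℝ × Vec n => γ * (T - q.1)) q • pd (dirS σ i) (drift σ W) q) D := by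
    intro q hq
    rw [h.pd_invMap _ hq]
    simp [dirS]
  have hc (q : ℝ × Vec n) : DifferentiableAt ℝ (fun q : ℝ × Vec n => γ * (T - q.1)) q := by fun_prop
  have hss (i : Fin n) : pd (dirS σ i) (pd (dirS σ i) (invMap σ γ T W)) p =
      (γ * (T - p.1)) • pd (dirS σ i) (pd (dirS σ i) (drift σ W)) p := by
    have hd := (contDiffOn_pd hD hdr (dirS σ i)).differentiableAt_of_isOpen hD hp
    rw [pd_congr hD (hs i) hp, pd_add (differentiableAt_const _) ((hc p).fun_smul hd),
      pd_smul (hc p) hd, pd_scale]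
    simp [pd, dirS]
  have e2 : heatOp σ (invMap σ γ T W) p =
      -γ • drift σ W p + (γ * (T - p.1)) • heatOp σ (drift σ W) p := by
    simp only [heatOp, hss, h.pd_invMap _ hp]
    rw [← Finset.smul_sum, smul_add, smul_comm (1 / 2 : ℝ), ← add_assoc]
    simp
  rw [e2, hop]
  simp only [fun i => hs i hp, smul_add, Finset.sum_add_distrib]
  congr 1
  rw [smul_comm]
  congr 1
  rw [Finset.smul_sum]
  refine Finset.sum_congr rfl fun i _ => ?_
  rw [smul_comm]

/-- The space-time change of variables `(t, z) ↦ (t, Ψ(t, z))`. -/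
noncomputable def shear (σ : Matrix (Fin n) (Fin n) ℝ) (γ T : ℝ) (W : ℝ × Vec n → ℝ)
    (p : ℝ × Vec n) : ℝ × Vec n :=
  (p.1, invMap σ γ T W p)

lemma IsBurgersPotential.hasFDerivAt_shear (h : IsBurgersPotential σ γ D W) {p : ℝ × Vec n}
    (hp : p ∈ D) :
    HasFDerivAt (shear σ γ T W) ((ContinuousLinearMap.fst ℝ ℝ (Vec n)).prod
      (fderiv ℝ (invMap σ γ T W) p)) p :=
  hasFDerivAt_fst.prodMk
    (h.contDiffOn_invMap.differentiableAt_of_isOpen h.isOpen hp).hasFDerivAt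

/-- The parabolic operator with directions `∂Ψ`, applied to `u`, read in the variables `(t, z)`:
the first-order terms created by the change of variables reduce to the transport term
`γ ⟨σ∇W, σ∇v⟩` because `Ψ` solves its own transport equation. -/
lemma IsBurgersPotential.parabolic_of_comp (h : IsBurgersPotential σ γ D W)
    {u v : ℝ × Vec n → ℝ} (hu : ContDiffOn ℝ ∞ u D) (hmaps : MapsTo (shear σ γ T W) D D)
    (hv : ∀ p ∈ D, v p = u (shear σ γ T W p)) {p : ℝ × Vec n} (hp : p ∈ D) :
    pd (1, 0) u (shear σ γ T W p) + 1 / 2 * ∑ i,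
        pd (0, pd (dirS σ i) (invMap σ γ T W) p) (pd (0, pd (dirS σ i) (invMap σ γ T W) p) u)
          (shear σ γ T W p) =
      heatOp σ v p + γ * ∑ i, pd (dirS σ i) W p * pd (dirS σ i) v p := by
  have hD := h.isOpen
  have hud {q} (hq : q ∈ D) := hu.differentiableAt_of_isOpen hD (hmaps hq)
  have hfirst (w : ℝ × Vec n) : EqOn (pd w v)
      (fun q => fderiv ℝ u (shear σ γ T W q) (w.1, pd w (invMap σ γ T W) q)) D := by
    intro q hq
    rw [pd_congr hD hv hq]
    have := (hud hq).hasFDerivAt.comp q (h.hasFDerivAt_shear (T := T) hq)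
    simp only [Function.comp_def] at this
    rw [pd, this.fderiv]
    simp [pd]
  have hsecond (i : Fin n) : pd (dirS σ i) (pd (dirS σ i) v) p =
      pd (0, pd (dirS σ i) (invMap σ γ T W) p) (pd (0, pd (dirS σ i) (invMap σ γ T W) p) u)
          (shear σ γ T W p) +
        fderiv ℝ u (shear σ γ T W p) (0, pd (dirS σ i) (pd (dirS σ i) (invMap σ γ T W)) p) := by
    rw [pd_congr hD (hfirst _) hp, pd_pd hD hu (hmaps hp)]
    have hd2 : DifferentiableAt ℝ (fderiv ℝ u) (shear σ γ T W p) :=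
      (hu.fderiv_of_isOpen hD (m := ∞) (by simp)).differentiableAt_of_isOpen hD (hmaps hp)
    have h1 := hd2.hasFDerivAt.comp p (h.hasFDerivAt_shear (T := T) hp)
    have h2 := (hasFDerivAt_const (dirS σ i).1 p).prodMk
      ((contDiffOn_pd hD (h.contDiffOn_invMap (T := T)) (dirS σ i)).differentiableAt_of_isOpen hD
        hp).hasFDerivAt
    have h3 := h1.clm_apply h2
    simp only [Function.comp_def] at h3
    rw [pd, h3.fderiv]
    simp [pd, dirS, add_comm]
  have hop := congrArg (fun x => fderiv ℝ u (shear σ γ T W p) ((0 : ℝ), x))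
    (h.heatOp_invMap (T := T) hp)
  set L := (fderiv ℝ u (shear σ γ T W p)).comp (ContinuousLinearMap.inr ℝ ℝ (Vec n)) with hL
  have hLa (x : Vec n) : fderiv ℝ u (shear σ γ T W p) ((0 : ℝ), x) = L x := rfl
  simp only [hLa, heatOp, map_add, map_smul, map_sum, smul_eq_mul] at hop
  have ht : pd (1, 0) v p = pd (1, 0) u (shear σ γ T W p) + L (pd (1, 0) (invMap σ γ T W) p) := by
    rw [hfirst _ hp, ← hLa, pd, ← map_add]
    simp
  have hi (i : Fin n) : pd (dirS σ i) v p = L (pd (dirS σ i) (invMap σ γ T W) p) := by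
    rw [hfirst _ hp, ← hLa]; simp [dirS]
  simp only [heatOp, smul_eq_mul, hsecond, ht, hi, hLa, Finset.sum_add_distrib]
  linarith

end BackwardOperator

section Convexity

/-! ### Gradients of convex functions -/

/-- A convex function lies above its tangent planes. -/
lemma add_fderiv_le_of_convexOn {X : Type*} [NormedAddCommGroup X] [NormedSpace ℝ X] {f : X → ℝ}
    (hf : ConvexOn ℝ univ f) {x : X} (hd : DifferentiableAt ℝ f x) (v : X) :
    f x + fderiv ℝ f x v ≤ f (x + v) := by
  have h := (hasDerivAt_line hd v).tendsto_slope_zero_right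
  have hle : ∀ᶠ τ : ℝ in 𝓝[>] 0,
      τ⁻¹ • (f (x + (0 + τ) • v) - f (x + (0 : ℝ) • v)) ≤ f (x + v) - f x := by
    filter_upwards [Ioo_mem_nhdsGT (zero_lt_one (α := ℝ))] with τ hτ
    have h1 := hf.2 (mem_univ x) (mem_univ (x + v)) (sub_nonneg.2 hτ.2.le) hτ.1.le (by ring)
    have h2 : (1 - τ) • x + τ • (x + v) = x + τ • v := by module
    rw [h2] at h1
    simp only [smul_eq_mul, zero_add, zero_smul, add_zero] at h1 ⊢
    rw [inv_mul_le_iff₀ hτ.1]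
    linarith
  have := le_of_tendsto h hle
  rw [pd] at this
  linarith

/-- Convergence of convex functions, along moving base points, implies convergence of their
derivatives as soon as the limit is differentiable. -/
lemma tendsto_fderiv_of_convexOn {X ι : Type*} [NormedAddCommGroup X] [NormedSpace ℝ X]
    {𝓕 : Filter ι} {g : ι → X → ℝ} {g₀ : X → ℝ} {z : ι → X} {z₀ : X}
    (hconv : ∀ᶠ i in 𝓕, ConvexOn ℝ univ (g i))
    (hdiff : ∀ᶠ i in 𝓕, DifferentiableAt ℝ (g i) (z i)) (hd₀ : DifferentiableAt ℝ g₀ z₀)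
    (hlim : ∀ v, Tendsto (fun i => g i (z i + v)) 𝓕 (𝓝 (g₀ (z₀ + v)))) (v : X) :
    Tendsto (fun i => fderiv ℝ (g i) (z i) v) 𝓕 (𝓝 (fderiv ℝ g₀ z₀ v)) := by
  have hlim0 : Tendsto (fun i => g i (z i)) 𝓕 (𝓝 (g₀ z₀)) := by simpa using hlim 0
  -- the derivative lies below the difference quotients, which converge; applied to `v` and `-v`
  have key (w : X) (c : ℝ) (hc : fderiv ℝ g₀ z₀ w < c) :
      ∀ᶠ i in 𝓕, fderiv ℝ (g i) (z i) w < c := by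
    have h := (hasDerivAt_line hd₀ w).tendsto_slope_zero_right
    obtain ⟨τ, hτc, hτ⟩ := ((h.eventually_lt_const hc).and self_mem_nhdsWithin).exists
    simp only [zero_add, zero_smul, add_zero] at hτc
    have h2 : Tendsto (fun i => τ⁻¹ • (g i (z i + τ • w) - g i (z i))) 𝓕
        (𝓝 (τ⁻¹ • (g₀ (z₀ + τ • w) - g₀ z₀))) := ((hlim _).sub hlim0).const_smul _
    filter_upwards [h2.eventually_lt_const hτc, hconv, hdiff] with i hi hci hdi
    refine lt_of_le_of_lt ?_ hi
    have h3 := add_fderiv_le_of_convexOn hci hdi (τ • w)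
    rw [map_smul, smul_eq_mul] at h3
    rw [smul_eq_mul, le_inv_mul_iff₀ hτ]
    linarith
  refine tendsto_order.2 ⟨fun c hc => ?_, fun c hc => key v c hc⟩
  filter_upwards [key (-v) (-c) (by rw [map_neg]; linarith)] with i hi
  rw [map_neg] at hi
  linarith

end Convexity

section Payoffs

/-! ### Payoffs of the class `C_l` -/

open scoped RealInnerProductSpace

variable {n : ℕ}

/-- The properties of the payoffs in `C_l` that matter: differentiability, convexity and a bound
of at most quadratic growth. -/
structure IsPayoff (A l : ℝ) (φ : Vec n → ℝ) : Prop where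
  differentiable : Differentiable ℝ φ
  convexOn : ConvexOn ℝ univ φ
  le : ∀ x, φ x ≤ A * ‖x‖ + l / 2 * ‖x‖ ^ 2

lemma sum_smul_single (v : Vec n) : ∑ i, v i • EuclideanSpace.single i (1 : ℝ) = v := by
  ext j
  simp [Pi.single_apply]

/-- The quadratic form of the Hessian matrix is the second derivative. -/
lemma hessian_quadratic {φ : Vec n → ℝ} (hφ : ContDiff ℝ 2 φ) (x v : Vec n) :
    fderiv ℝ (fderiv ℝ φ) x v v = v.ofLp ⬝ᵥ (hessian φ x).mulVec v.ofLp := by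
  have hd : Differentiable ℝ (fderiv ℝ φ) :=
    (hφ.fderiv_right (m := 1) (by norm_num)).differentiable (by simp)
  have h (i j : Fin n) : hessian φ x i j = fderiv ℝ (fderiv ℝ φ) x
      (EuclideanSpace.single i 1) (EuclideanSpace.single j 1) := by
    have h1 : HasFDerivAt (partialDeriv j φ) _ x :=
      (hd x).hasFDerivAt.clm_apply (hasFDerivAt_const (EuclideanSpace.single j (1 : ℝ)) x)
    simp only [hessian, Matrix.of_apply]
    rw [partialDeriv, h1.fderiv]
    simp
  conv_lhs => rw [← sum_smul_single v]
  simp only [map_sum, map_smul, sum_apply, smul_apply,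
    dotProduct, Matrix.mulVec, smul_eq_mul, h, Finset.mul_sum]
  rw [Finset.sum_comm]
  exact Finset.sum_congr rfl fun i _ => Finset.sum_congr rfl fun j _ => by ring

/-- Members of `C_l` are payoffs, with a linear growth constant that depends only on an upper
bound on the unit ball. -/
lemma isPayoff_of_mem_classC {l A : ℝ} {φ : Vec n → ℝ} (hφ : φ ∈ ClassC n l)
    (hA : ∀ h, ‖h‖ ≤ 1 → φ h ≤ A) : IsPayoff A l φ := by
  obtain ⟨hC, hH, h0⟩ := hφ
  have hd1 : Differentiable ℝ φ := hC.differentiable (by norm_num)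
  have hd2 : Differentiable ℝ (fderiv ℝ φ) :=
    (hC.fderiv_right (m := 1) (by norm_num)).differentiable (by simp)
  have hline (x v : Vec n) (τ : ℝ) : HasDerivAt (fun τ : ℝ => x + τ • v) v τ := by
    simpa using ((hasDerivAt_id τ).smul_const v).const_add x
  have hg1 (x v : Vec n) (τ : ℝ) :
      HasDerivAt (fun τ : ℝ => φ (x + τ • v)) (fderiv ℝ φ (x + τ • v) v) τ :=
    (hd1 _).hasFDerivAt.comp_hasDerivAt τ (hline x v τ)
  have hg2 (x v : Vec n) (τ : ℝ) : HasDerivAt (fun τ : ℝ => fderiv ℝ φ (x + τ • v) v)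
      (fderiv ℝ (fderiv ℝ φ) (x + τ • v) v v) τ := by
    have h := ((hd2 _).hasFDerivAt.comp_hasDerivAt τ (hline x v τ)).clm_apply
      (hasDerivAt_const τ v)
    simpa using h
  have hpos (x v : Vec n) : 0 ≤ fderiv ℝ (fderiv ℝ φ) x v v := by
    rw [hessian_quadratic hC]
    simpa using (hH x).1.dotProduct_mulVec_nonneg v.ofLp
  have hle (x v : Vec n) : fderiv ℝ (fderiv ℝ φ) x v v ≤ l * ‖v‖ ^ 2 := by
    rw [hessian_quadratic hC]
    have h := (hH x).2.posSemidef.dotProduct_mulVec_nonneg v.ofLp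
    have h2 : v.ofLp ⬝ᵥ v.ofLp = ‖v‖ ^ 2 := by
      rw [EuclideanSpace.real_norm_sq_eq]
      exact Finset.sum_congr rfl fun i _ => by ring
    simp only [star_trivial, Matrix.sub_mulVec, Matrix.smul_mulVec, Matrix.one_mulVec,
      dotProduct_sub, dotProduct_smul, h2, smul_eq_mul] at h
    linarith
  have hconv1 (x v : Vec n) : ConvexOn ℝ univ fun τ : ℝ => φ (x + τ • v) := by
    have hder : deriv (fun τ : ℝ => φ (x + τ • v)) = fun τ => fderiv ℝ φ (x + τ • v) v :=
      funext fun τ => (hg1 x v τ).deriv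
    refine convexOn_univ_of_deriv2_nonneg (fun τ => (hg1 x v τ).differentiableAt) ?_ fun τ => ?_
    · rw [hder]; exact fun τ => (hg2 x v τ).differentiableAt
    · rw [Function.iterate_succ, Function.iterate_one, Function.comp_apply, hder,
        (hg2 x v τ).deriv]
      exact hpos _ _
  have hconv : ConvexOn ℝ univ φ := by
    refine ⟨convex_univ, fun x _ y _ a b ha hb hab => ?_⟩
    have h := (hconv1 x (y - x)).2 (mem_univ 0) (mem_univ 1) ha hb hab
    have e : x + b • (y - x) = a • x + b • y := by
      rw [← eq_sub_iff_add_eq] at hab; rw [hab]; module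
    simpa [e] using h
  refine ⟨hd1, hconv, fun x => ?_⟩
  -- the quadratic bound: `τ ↦ l ‖x‖² τ² / 2 - φ (τ x)` is convex
  have hq1 (τ : ℝ) : HasDerivAt (fun τ : ℝ => l * ‖x‖ ^ 2 / 2 * τ ^ 2 - φ (0 + τ • x))
      (l * ‖x‖ ^ 2 * τ - fderiv ℝ φ (0 + τ • x) x) τ := by
    refine (((hasDerivAt_id τ).fun_pow 2).const_mul (l * ‖x‖ ^ 2 / 2)).fun_sub (hg1 0 x τ)
      |>.congr_deriv ?_
    simp only [id]; ring
  have hq2 (τ : ℝ) : HasDerivAt (fun τ : ℝ => l * ‖x‖ ^ 2 * τ - fderiv ℝ φ (0 + τ • x) x)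
      (l * ‖x‖ ^ 2 - fderiv ℝ (fderiv ℝ φ) (0 + τ • x) x x) τ := by
    refine ((hasDerivAt_id τ).const_mul (l * ‖x‖ ^ 2)).fun_sub (hg2 0 x τ) |>.congr_deriv ?_
    ring
  have hqd : deriv (fun τ : ℝ => l * ‖x‖ ^ 2 / 2 * τ ^ 2 - φ (0 + τ • x)) =
      fun τ => l * ‖x‖ ^ 2 * τ - fderiv ℝ φ (0 + τ • x) x := funext fun τ => (hq1 τ).deriv
  have hqc : ConvexOn ℝ univ fun τ : ℝ => l * ‖x‖ ^ 2 / 2 * τ ^ 2 - φ (0 + τ • x) := by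
    refine convexOn_univ_of_deriv2_nonneg (fun τ => (hq1 τ).differentiableAt) ?_ fun τ => ?_
    · rw [hqd]; exact fun τ => (hq2 τ).differentiableAt
    · rw [Function.iterate_succ, Function.iterate_one, Function.comp_apply, hqd, (hq2 τ).deriv]
      linarith [hle (0 + τ • x) x]
  have h1 := add_fderiv_le_of_convexOn hqc (hq1 0).differentiableAt (1 : ℝ)
  rw [show fderiv ℝ (fun τ : ℝ => l * ‖x‖ ^ 2 / 2 * τ ^ 2 - φ (0 + τ • x)) 0 1 =
    l * ‖x‖ ^ 2 * 0 - fderiv ℝ φ (0 + (0 : ℝ) • x) x from (hq1 0).deriv] at h1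
  simp only [zero_add, zero_smul, one_smul, h0] at h1
  -- the derivative at the origin is bounded by the values on the unit sphere
  have h2 : fderiv ℝ φ 0 x ≤ A * ‖x‖ := by
    rcases eq_or_ne x 0 with rfl | hx
    · simp
    · have hx' : 0 < ‖x‖ := norm_pos_iff.2 hx
      have h3 := add_fderiv_le_of_convexOn hconv (hd1 0) (‖x‖⁻¹ • x)
      have h4 := hA (‖x‖⁻¹ • x) (by rw [norm_smul, norm_inv, norm_norm, inv_mul_cancel₀ hx'.ne'])
      rw [h0, zero_add, zero_add, map_smul, smul_eq_mul] at h3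
      have h5 := h3.trans h4
      rwa [inv_mul_le_iff₀ hx', mul_comm] at h5
  nlinarith

/-! ### Symmetric matrices acting on Euclidean space -/

section Act

variable (M N : Matrix (Fin n) (Fin n) ℝ) (x y : Vec n)

lemma act_add : act M (x + y) = act M x + act M y := map_add _ _ _
lemma act_sub : act M (x - y) = act M x - act M y := map_sub _ _ _
lemma act_smul (c : ℝ) : act M (c • x) = c • act M x := map_smul _ _ _
lemma act_mul : act (M * N) x = act M (act N x) := by simp [act]
lemma act_one : act 1 x = x := by simp [act]
lemma act_apply (i : Fin n) : act M x i = ∑ j, M i j * x j := by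
  rw [act, Matrix.ofLp_toEuclideanCLM]; rfl

@[fun_prop]
lemma continuous_act : Continuous (act M) := (Matrix.toEuclideanCLM (𝕜 := ℝ) M).continuous

variable {M}

lemma act_inv_act (hM : IsUnit M.det) : act M⁻¹ (act M x) = x := by
  rw [← act_mul, Matrix.nonsing_inv_mul _ hM, act_one]

lemma act_act_inv (hM : IsUnit M.det) : act M (act M⁻¹ x) = x := by
  rw [← act_mul, Matrix.mul_nonsing_inv _ hM, act_one]

lemma inner_act (hM : M.IsHermitian) : ⟪act M x, y⟫ = ⟪x, act M y⟫ := by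
  have h (i j) : M i j = M j i := by simpa using (hM.apply i j).symm
  simp only [PiLp.inner_apply, act_apply, RCLike.inner_apply, conj_trivial, Finset.mul_sum,
    Finset.sum_mul]
  rw [Finset.sum_comm]
  exact Finset.sum_congr rfl fun i _ => Finset.sum_congr rfl fun j _ => by rw [h]; ring

/-- A positive definite matrix expands lengths at most by its largest eigenvalue. -/
lemma norm_act_le (hM : M.PosDef) : ‖act M x‖ ≤ maxEigenvalue M * ‖x‖ := by
  have hH := hM.isHermitian
  let b := hH.eigenvectorBasis
  have hle (i : Fin n) : hH.eigenvalues i ≤ maxEigenvalue M := by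
    refine le_csSup ?_ (hH.eigenvalues_mem_spectrum_real i)
    rw [hH.spectrum_real_eq_range_eigenvalues]
    exact (Set.finite_range _).bddAbove
  have hpos (i : Fin n) : 0 < hH.eigenvalues i := hM.eigenvalues_pos i
  have hb (i : Fin n) : act M (b i) = hH.eigenvalues i • b i := by
    ext j
    have := congrFun (hH.mulVec_eigenvectorBasis i) j
    rw [act_apply]
    simpa [Matrix.mulVec, dotProduct] using this
  have hcoef (i : Fin n) : ⟪b i, act M x⟫ = hH.eigenvalues i * ⟪b i, x⟫ := by
    rw [← inner_act _ _ hH, hb, real_inner_smul_left]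
  have hsq : ‖act M x‖ ^ 2 ≤ maxEigenvalue M ^ 2 * ‖x‖ ^ 2 := by
    rw [← b.sum_sq_norm_inner_right, ← b.sum_sq_norm_inner_right x, Finset.mul_sum]
    refine Finset.sum_le_sum fun i _ => ?_
    rw [hcoef, norm_mul, mul_pow]
    gcongr
    rw [Real.norm_of_nonneg (hpos i).le]
    exact hle i
  rcases isEmpty_or_nonempty (Fin n) with h | ⟨⟨i⟩⟩
  · have : x = 0 := Subsingleton.elim _ _
    subst this
    simp [act]
  · have hm : 0 ≤ maxEigenvalue M := (hpos i).le.trans (hle i)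
    rw [← mul_pow] at hsq
    exact le_of_sq_le_sq hsq (by positivity)

lemma maxEigenvalue_pos (hn : 1 ≤ n) (hM : M.PosDef) : 0 < maxEigenvalue M := by
  have hH := hM.isHermitian
  refine (hM.eigenvalues_pos ⟨0, hn⟩).trans_le (le_csSup ?_
    (hH.eigenvalues_mem_spectrum_real _))
  rw [hH.spectrum_real_eq_range_eigenvalues]
  exact (Set.finite_range _).bddAbove

end Act

end Payoffs

section Potential

/-! ### The potential -/

open scoped RealInnerProductSpace ContDiff

variable {n : ℕ} {σ : Matrix (Fin n) (Fin n) ℝ} {γ T A l : ℝ} {φ : Vec n → ℝ}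

/-- The exponential moment `𝔼 exp (γ φ (z + √(T - t) σ Z))` for a standard Gaussian vector `Z`. -/
noncomputable def cole (σ : Matrix (Fin n) (Fin n) ℝ) (γ T : ℝ) (φ : Vec n → ℝ)
    (p : ℝ × Vec n) : ℝ :=
  ∫ w, Real.exp (γ * φ (p.2 + √(T - p.1) • act σ w)) ∂(stdGaussian (Vec n))

/-- The function `E`, written with a Gaussian vector. In contrast with `E` it makes sense, and is
smooth, also for slightly negative times. -/
noncomputable def potential (σ : Matrix (Fin n) (Fin n) ℝ) (γ T : ℝ) (φ : Vec n → ℝ)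
    (p : ℝ × Vec n) : ℝ :=
  1 / γ * Real.log (cole σ γ T φ p)

/-- The open set of times before `T` and positions on which the potential is smooth. -/
def potDomain (n : ℕ) (κ T : ℝ) : Set (ℝ × Vec n) := {p | p.1 < T ∧ κ * (T - p.1) < 1}

lemma isOpen_potDomain (κ T : ℝ) : IsOpen (potDomain n κ T) :=
  (isOpen_lt continuous_fst continuous_const).inter
    (isOpen_lt (by fun_prop : Continuous fun p : ℝ × Vec n => κ * (T - p.1)) continuous_const)

/-- The exponent in `cole` is bounded by a quadratic polynomial in `‖w‖`, uniformly for bounded `z`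
and `s`. The leading coefficient is below `1 / 2`, so that its exponential is integrable, precisely
when `γ l λ² S < 1` with `λ` the largest eigenvalue of `σ`. -/
lemma IsPayoff.growth (hφ : IsPayoff A l φ) (hσ : σ.PosDef) (hγ : 0 < γ) (hl : 0 ≤ l) (hA : 0 ≤ A)
    {R S s : ℝ} {z : Vec n} (hz : ‖z‖ ≤ R) (hs : s ≤ S) (w : Vec n) :
    γ * φ (z + √s • act σ w) ≤ γ * l * maxEigenvalue σ ^ 2 * √S ^ 2 / 2 * ‖w‖ ^ 2 +
      γ * (A + l * R) * √S * maxEigenvalue σ * ‖w‖ + γ * (A * R + l / 2 * R ^ 2) := by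
  have h1 : ‖z + √s • act σ w‖ ≤ R + √S * (maxEigenvalue σ * ‖w‖) := by
    refine (norm_add_le _ _).trans (add_le_add hz ?_)
    rw [norm_smul, Real.norm_of_nonneg (Real.sqrt_nonneg _)]
    exact mul_le_mul (Real.sqrt_le_sqrt hs) (norm_act_le w hσ) (norm_nonneg _) (Real.sqrt_nonneg _)
  have h2 : φ (z + √s • act σ w) ≤ A * (R + √S * (maxEigenvalue σ * ‖w‖)) +
      l / 2 * (R + √S * (maxEigenvalue σ * ‖w‖)) ^ 2 := (hφ.le _).trans (by gcongr)
  refine (mul_le_mul_of_nonneg_left h2 hγ.le).trans_eq ?_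
  ring

lemma IsPayoff.integrable_exp (hφ : IsPayoff A l φ) (hσ : σ.PosDef) (hγ : 0 < γ) (hl : 0 ≤ l)
    (hA : 0 ≤ A) {s : ℝ} (hs0 : 0 ≤ s) (hs : γ * l * maxEigenvalue σ ^ 2 * s < 1) (z : Vec n) :
    Integrable (fun w => Real.exp (γ * φ (z + √s • act σ w))) (stdGaussian (Vec n)) := by
  have hc := hφ.differentiable.continuous
  refine (integrable_stdGaussian_exp_quadratic (a := γ * l * maxEigenvalue σ ^ 2 * √s ^ 2 / 2) ?_
    (γ * (A + l * ‖z‖) * √s * maxEigenvalue σ) (γ * (A * ‖z‖ + l / 2 * ‖z‖ ^ 2))).mono'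
    (Continuous.aestronglyMeasurable (by fun_prop)) (ae_of_all _ fun w => ?_)
  · rw [Real.sq_sqrt hs0]; linarith
  · rw [Real.norm_of_nonneg (Real.exp_pos _).le, Real.exp_le_exp]
    exact hφ.growth hσ hγ hl hA le_rfl le_rfl w

lemma IsPayoff.cole_pos (hφ : IsPayoff A l φ) (hσ : σ.PosDef) (hγ : 0 < γ) (hl : 0 ≤ l)
    (hA : 0 ≤ A) {p : ℝ × Vec n} (hp : p.1 ≤ T)
    (hs : γ * l * maxEigenvalue σ ^ 2 * (T - p.1) < 1) : 0 < cole σ γ T φ p :=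
  integral_exp_pos (hφ.integrable_exp hσ hγ hl hA (sub_nonneg.2 hp) hs p.2)

/-- Continuity of the exponential moments jointly in the payoff and in the base point. -/
lemma tendsto_cole {ι : Type*} {𝓕 : Filter ι} [𝓕.IsCountablyGenerated] {φs : ι → Vec n → ℝ}
    {p : ι → ℝ × Vec n} {p₀ : ℝ × Vec n} (hφs : ∀ᶠ i in 𝓕, IsPayoff A l (φs i))
    (hφ : ∀ (x : ι → Vec n) (x₀ : Vec n), Tendsto x 𝓕 (𝓝 x₀) →
      Tendsto (fun i => φs i (x i)) 𝓕 (𝓝 (φ x₀)))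
    (hσ : σ.PosDef) (hγ : 0 < γ) (hl : 0 ≤ l) (hA : 0 ≤ A) (hp : Tendsto p 𝓕 (𝓝 p₀))
    (hp₀ : p₀.1 ≤ T) (hs : γ * l * maxEigenvalue σ ^ 2 * (T - p₀.1) < 1) :
    Tendsto (fun i => cole σ γ T (φs i) (p i)) 𝓕 (𝓝 (cole σ γ T φ p₀)) := by
  have hp1 : Tendsto (fun i => (p i).1) 𝓕 (𝓝 p₀.1) := (continuous_fst.tendsto p₀).comp hp
  have hp2 : Tendsto (fun i => (p i).2) 𝓕 (𝓝 p₀.2) := (continuous_snd.tendsto p₀).comp hp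
  obtain ⟨S, hSκ, hS⟩ : ∃ S, γ * l * maxEigenvalue σ ^ 2 * S < 1 ∧ T - p₀.1 < S := by
    have hc : Tendsto (fun S => γ * l * maxEigenvalue σ ^ 2 * S) (𝓝[>] (T - p₀.1))
        (𝓝 (γ * l * maxEigenvalue σ ^ 2 * (T - p₀.1))) :=
      (Continuous.tendsto (by fun_prop) _).mono_left nhdsWithin_le_nhds
    exact ((hc.eventually_lt_const hs).and self_mem_nhdsWithin).exists
  refine tendsto_integral_filter_of_dominated_convergence _ ?_ ?_
    (integrable_stdGaussian_exp_quadratic (a := γ * l * maxEigenvalue σ ^ 2 * √S ^ 2 / 2) ?_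
      (γ * (A + l * (‖p₀.2‖ + 1)) * √S * maxEigenvalue σ)
      (γ * (A * (‖p₀.2‖ + 1) + l / 2 * (‖p₀.2‖ + 1) ^ 2))) (ae_of_all _ fun w => ?_)
  · filter_upwards [hφs] with i hi
    have hc := hi.differentiable.continuous
    exact Continuous.aestronglyMeasurable (by fun_prop)
  · filter_upwards [hφs, (hp1.const_sub T).eventually_lt_const hS,
      hp2.norm.eventually_lt_const (lt_add_one _)] with i hi h1 h2
    refine ae_of_all _ fun w => ?_
    rw [Real.norm_of_nonneg (Real.exp_pos _).le, Real.exp_le_exp]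
    exact hi.growth hσ hγ hl hA h2.le h1.le w
  · rw [Real.sq_sqrt (by linarith)]; linarith
  · refine (Real.continuous_exp.tendsto _).comp ((hφ _ _ ?_).const_mul γ)
    exact hp2.add (((Real.continuous_sqrt.tendsto _).comp (hp1.const_sub T)).smul_const _)

lemma tendsto_potential {ι : Type*} {𝓕 : Filter ι} [𝓕.IsCountablyGenerated] {φs : ι → Vec n → ℝ}
    {p : ι → ℝ × Vec n} {p₀ : ℝ × Vec n} (hφs : ∀ᶠ i in 𝓕, IsPayoff A l (φs i))
    (hφ₀ : IsPayoff A l φ)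
    (hφ : ∀ (x : ι → Vec n) (x₀ : Vec n), Tendsto x 𝓕 (𝓝 x₀) →
      Tendsto (fun i => φs i (x i)) 𝓕 (𝓝 (φ x₀)))
    (hσ : σ.PosDef) (hγ : 0 < γ) (hl : 0 ≤ l) (hA : 0 ≤ A) (hp : Tendsto p 𝓕 (𝓝 p₀))
    (hp₀ : p₀.1 ≤ T) (hs : γ * l * maxEigenvalue σ ^ 2 * (T - p₀.1) < 1) :
    Tendsto (fun i => potential σ γ T (φs i) (p i)) 𝓕 (𝓝 (potential σ γ T φ p₀)) :=
  ((tendsto_cole hφs hφ hσ hγ hl hA hp hp₀ hs).log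
    (hφ₀.cole_pos hσ hγ hl hA hp₀ hs).ne').const_mul _

lemma IsPayoff.continuousAt_potential (hφ : IsPayoff A l φ) (hσ : σ.PosDef) (hγ : 0 < γ)
    (hl : 0 ≤ l) (hA : 0 ≤ A) {p₀ : ℝ × Vec n} (hp₀ : p₀.1 ≤ T)
    (hs : γ * l * maxEigenvalue σ ^ 2 * (T - p₀.1) < 1) :
    ContinuousAt (potential σ γ T φ) p₀ :=
  tendsto_potential (Eventually.of_forall fun _ => hφ) hφ
    (fun _ x₀ hx => (hφ.differentiable.continuous.tendsto x₀).comp hx) hσ hγ hl hA tendsto_id hp₀ hs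

/-- Logarithms of integrals of exponentials of convex functions are convex. -/
lemma convexOn_log_integral_exp {α X : Type*} [MeasurableSpace α] {μ : Measure α}
    [NeZero μ] [AddCommGroup X] [Module ℝ X] {g : α → X → ℝ} (hg : ∀ y, ConvexOn ℝ univ (g y))
    (hi : ∀ x, Integrable (fun y => Real.exp (g y x)) μ) :
    ConvexOn ℝ univ fun x => Real.log (∫ y, Real.exp (g y x) ∂μ) := by
  refine ⟨convex_univ, fun x _ y _ a b ha hb hab => ?_⟩
  set I := fun x => ∫ y, Real.exp (g y x) ∂μ with hI
  have hpos (x) : 0 < I x := integral_exp_pos (hi x)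
  have hexp (x) (y : α) : Real.exp (g y x - Real.log (I x)) = Real.exp (g y x) / I x := by
    rw [Real.exp_sub, Real.exp_log (hpos x)]
  have hint (x) : Integrable (fun y => Real.exp (g y x - Real.log (I x))) μ := by
    simp_rw [hexp]; exact (hi x).div_const _
  have hone (x) : ∫ y, Real.exp (g y x - Real.log (I x)) ∂μ = 1 := by
    simp_rw [hexp]; rw [integral_div, div_self (hpos x).ne']
  set c := a • Real.log (I x) + b • Real.log (I y) with hc
  change Real.log (I (a • x + b • y)) ≤ c
  rw [Real.log_le_iff_le_exp (hpos _)]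
  -- after normalization the integrands are dominated by convexity of the exponential
  have key : ∀ η, Real.exp (g η (a • x + b • y)) ≤ Real.exp c *
      (a * Real.exp (g η x - Real.log (I x)) + b * Real.exp (g η y - Real.log (I y))) := by
    intro η
    have h1 := (hg η).2 (mem_univ x) (mem_univ y) ha hb hab
    have h2 := convexOn_exp.2 (mem_univ (g η x - Real.log (I x)))
      (mem_univ (g η y - Real.log (I y))) ha hb hab
    simp only [smul_eq_mul] at h1 h2 hc
    calc Real.exp (g η (a • x + b • y)) ≤ Real.exp (c + (a * (g η x - Real.log (I x)) +
          b * (g η y - Real.log (I y)))) := by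
          rw [Real.exp_le_exp, hc]; linarith
      _ ≤ _ := by
          rw [Real.exp_add]; gcongr
  calc I (a • x + b • y) ≤ ∫ η, Real.exp c *
      (a * Real.exp (g η x - Real.log (I x)) + b * Real.exp (g η y - Real.log (I y))) ∂μ :=
        integral_mono (hi _)
          ((((hint x).const_mul a).add ((hint y).const_mul b)).const_mul _) key
    _ = Real.exp c := by
        rw [integral_const_mul, integral_add ((hint x).const_mul a) ((hint y).const_mul b),
          integral_const_mul, integral_const_mul, hone, hone]
        simp [hab]

lemma IsPayoff.convexOn_potential (hφ : IsPayoff A l φ) (hσ : σ.PosDef) (hγ : 0 < γ) (hl : 0 ≤ l)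
    (hA : 0 ≤ A) {t : ℝ} (ht : t ≤ T) (hs : γ * l * maxEigenvalue σ ^ 2 * (T - t) < 1) :
    ConvexOn ℝ univ fun z => potential σ γ T φ (t, z) := by
  have h := convexOn_log_integral_exp (μ := stdGaussian (Vec n))
    (g := fun w z => γ * φ (z + √(T - t) • act σ w)) (fun w => ?_)
    fun z => hφ.integrable_exp hσ hγ hl hA (sub_nonneg.2 ht) hs z
  · exact (h.smul (by positivity : 0 ≤ 1 / γ))
  · have := (hφ.convexOn.translate_left (√(T - t) • act σ w)).smul hγ.le
    simpa using this

lemma potential_terminal (hγ : γ ≠ 0) (z : Vec n) : potential σ γ T φ (T, z) = φ z := by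
  simp [potential, cole, hγ]

lemma IsPayoff.gaussGrowth (hφ : IsPayoff A l φ) (hσ : σ.PosDef) (hγ : 0 < γ) (hl : 0 ≤ l)
    (hA : 0 ≤ A) :
    GaussGrowth (γ * l * maxEigenvalue σ ^ 2) fun y => Real.exp (γ * φ (act σ y)) := by
  have hc := hφ.differentiable.continuous
  refine ⟨Continuous.aestronglyMeasurable (by fun_prop), fun a b ha => ?_⟩
  refine (integrable_exp_quadratic (sub_pos.2 ha) (b + γ * A * maxEigenvalue σ)).mono'
    (Continuous.aestronglyMeasurable (by fun_prop)) (ae_of_all _ fun y => ?_)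
  rw [Real.norm_of_nonneg (by positivity), Real.norm_of_nonneg (by positivity), ← Real.exp_add,
    Real.exp_le_exp]
  have := hφ.growth hσ hγ hl hA (R := 0) (S := 1) (s := 1) (z := 0) (by simp) le_rfl y
  simp only [Real.sqrt_one, one_smul, zero_add] at this
  linarith

/-- The affine change of variables turning `cole` into the heat semigroup. -/
noncomputable def normalize (σ : Matrix (Fin n) (Fin n) ℝ) (T : ℝ) (p : ℝ × Vec n) : ℝ × Vec n :=
  (T - p.1, act σ⁻¹ p.2)

lemma hasFDerivAt_normalize (p : ℝ × Vec n) :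
    HasFDerivAt (normalize σ T) ((-ContinuousLinearMap.fst ℝ ℝ (Vec n)).prod
      ((Matrix.toEuclideanCLM (𝕜 := ℝ) σ⁻¹).comp (ContinuousLinearMap.snd ℝ ℝ (Vec n)))) p :=
  (hasFDerivAt_fst.const_sub T).prodMk
    ((Matrix.toEuclideanCLM (𝕜 := ℝ) σ⁻¹).hasFDerivAt.comp p hasFDerivAt_snd)

lemma contDiff_normalize : ContDiff ℝ ∞ (normalize σ T) :=
  (contDiff_const.sub contDiff_fst).prodMk
    ((Matrix.toEuclideanCLM (𝕜 := ℝ) σ⁻¹).contDiff.comp contDiff_snd)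

lemma cole_eq_heat (hσ : IsUnit σ.det) (p : ℝ × Vec n) :
    cole σ γ T φ p = heat (fun y => Real.exp (γ * φ (act σ y))) (normalize σ T p) := by
  simp only [cole, heat, normalize, act_add, act_smul, act_act_inv _ hσ]

lemma mapsTo_normalize {κ : ℝ} : MapsTo (normalize σ T) (potDomain n κ T) (heatDomain n κ) :=
  fun _ hp => ⟨sub_pos.2 hp.1, hp.2⟩

lemma IsPayoff.contDiffOn_cole (hφ : IsPayoff A l φ) (hσ : σ.PosDef) (hγ : 0 < γ) (hl : 0 ≤ l)
    (hA : 0 ≤ A) :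
    ContDiffOn ℝ ∞ (cole σ γ T φ) (potDomain n (γ * l * maxEigenvalue σ ^ 2) T) :=
  ((contDiffOn_heat (hφ.gaussGrowth hσ hγ hl hA)).comp contDiff_normalize.contDiffOn
    mapsTo_normalize).congr fun p _ => cole_eq_heat hσ.det_pos.ne'.isUnit p

lemma IsPayoff.heatOp_cole (hφ : IsPayoff A l φ) (hσ : σ.PosDef) (hγ : 0 < γ) (hl : 0 ≤ l)
    (hA : 0 ≤ A) {p : ℝ × Vec n} (hp : p ∈ potDomain n (γ * l * maxEigenvalue σ ^ 2) T) :
    heatOp σ (cole σ γ T φ) p = 0 := by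
  set κ := γ * l * maxEigenvalue σ ^ 2
  have hdet : IsUnit σ.det := hσ.det_pos.ne'.isUnit
  set f : Vec n → ℝ := fun y => Real.exp (γ * φ (act σ y))
  have hf : GaussGrowth κ f := hφ.gaussGrowth hσ hγ hl hA
  have hu := contDiffOn_heat hf
  have hO := isOpen_potDomain (n := n) κ T
  have hcole : cole σ γ T φ = fun p => heat f (normalize σ T p) :=
    funext fun p => cole_eq_heat hdet p
  have hdn (q : ℝ × Vec n) := (hasFDerivAt_normalize (σ := σ) (T := T) q).differentiableAt
  have hS (i : Fin n) (q) : pd (dirS σ i) (normalize σ T) q = dirX i := by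
    rw [pd, (hasFDerivAt_normalize q).fderiv]
    have : (Matrix.toEuclideanCLM (𝕜 := ℝ) σ⁻¹) (act σ (EuclideanSpace.single i 1)) =
        EuclideanSpace.single i 1 := act_inv_act _ hdet
    simp [dirS, dirX, this]
  have h1 (i : Fin n) : EqOn (pd (dirS σ i) (cole σ γ T φ))
      (fun q => pd (dirX i) (heat f) (normalize σ T q)) (potDomain n κ T) := by
    intro q hq
    rw [hcole, pd_comp (hu.differentiableAt_of_isOpen isOpen_heatDomain (mapsTo_normalize hq))
      (hdn q), hS]
  have h2 (i : Fin n) : pd (dirS σ i) (pd (dirS σ i) (cole σ γ T φ)) p =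
      pd (dirX i) (pd (dirX i) (heat f)) (normalize σ T p) := by
    rw [pd_congr hO (h1 i) hp, pd_comp ((contDiffOn_pd isOpen_heatDomain hu
      _).differentiableAt_of_isOpen isOpen_heatDomain (mapsTo_normalize hp)) (hdn p), hS]
  have h3 : pd (1, 0) (cole σ γ T φ) p = -pd (1, 0) (heat f) (normalize σ T p) := by
    have : pd ((1 : ℝ), (0 : Vec n)) (normalize σ T) p = -((1 : ℝ), (0 : Vec n)) := by
      rw [pd, (hasFDerivAt_normalize p).fderiv]; simp
    rw [hcole, pd_comp (hu.differentiableAt_of_isOpen isOpen_heatDomain (mapsTo_normalize hp))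
      (hdn p), this, pd, map_neg, pd]
  rw [heatOp, h3, pd_heat hf (mapsTo_normalize hp)]
  simp [h2]

/-- The potential is a smooth solution of the backward equation with quadratic gradient term. -/
lemma IsPayoff.isBurgersPotential (hφ : IsPayoff A l φ) (hσ : σ.PosDef) (hγ : 0 < γ) (hl : 0 ≤ l)
    (hA : 0 ≤ A) :
    IsBurgersPotential σ γ (potDomain n (γ * l * maxEigenvalue σ ^ 2) T) (potential σ γ T φ) := by
  have hpos (p : ℝ × Vec n) (hp : p ∈ potDomain n (γ * l * maxEigenvalue σ ^ 2) T) :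
      0 < cole σ γ T φ p := hφ.cole_pos hσ hγ hl hA hp.1.le hp.2
  have hW : ContDiffOn ℝ ∞ (potential σ γ T φ) (potDomain n (γ * l * maxEigenvalue σ ^ 2) T) :=
    contDiffOn_const.mul ((hφ.contDiffOn_cole hσ hγ hl hA).log fun p hp => (hpos p hp).ne')
  refine ⟨isOpen_potDomain _ _, hW, fun p hp => heatOp_of_exp (isOpen_potDomain _ _) hW hγ.ne'
    (U := cole σ γ T φ) (fun q hq => ?_) (fun q hq => hφ.heatOp_cole hσ hγ hl hA hq) hp⟩
  rw [potential, ← mul_assoc, mul_one_div_cancel hγ.ne', one_mul, Real.exp_log (hpos q hq)]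

/-- `E` is the potential, by the Gaussian law of the Brownian increments. -/
lemma E_eq_potential {Ω : Type*} [MeasurableSpace Ω] {P : Measure Ω}
    [IsProbabilityMeasure P] {B : ℝ≥0 → Ω → Vec n} (hB : IsBrownianVec B P) (hφ : Continuous φ)
    {t : ℝ} (ht : t ∈ Icc 0 T) (z : Vec n) :
    E P B σ γ T φ t z = potential σ γ T φ (t, z) ∧
      (Integrable (expPayoff B σ γ T φ t z) P ↔
        Integrable (fun w => Real.exp (γ * φ (z + √(T - t) • act σ w))) (stdGaussian (Vec n))) := by
  obtain ⟨hm, hlaw⟩ := hB.map_sub T.toNNReal t.toNNReal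
  have hdist : (nndist (T.toNNReal).1 (t.toNNReal).1 : ℝ) = T - t := by
    simp only [coe_nndist, NNReal.val_eq_coe, Real.coe_toNNReal _ ht.1,
      Real.coe_toNNReal _ (ht.1.trans ht.2), Real.dist_eq]
    exact abs_of_nonneg (sub_nonneg.2 ht.2)
  rw [hdist] at hlaw
  have hg : Continuous fun x => Real.exp (γ * φ (z + act σ x)) := by fun_prop
  have h1 : expPayoff B σ γ T φ t z =
      (fun x => Real.exp (γ * φ (z + act σ x))) ∘ fun y => B T.toNNReal y - B t.toNNReal y := rfl
  have h2 : (fun w => Real.exp (γ * φ (z + √(T - t) • act σ w))) =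
      (fun x => Real.exp (γ * φ (z + act σ x))) ∘ fun w => √(T - t) • w := by
    ext w; simp [act_smul]
  have hm2 : AEMeasurable (fun w : Vec n => √(T - t) • w) (stdGaussian (Vec n)) := by fun_prop
  constructor
  · rw [E, potential, cole]
    simp only
    rw [h2, h1]
    simp only [Function.comp_def]
    rw [← integral_map hm hg.aestronglyMeasurable, hlaw,
      integral_map hm2 hg.aestronglyMeasurable]
  · rw [h1, h2, ← integrable_map_measure hg.aestronglyMeasurable hm, hlaw,
      integrable_map_measure hg.aestronglyMeasurable hm2]

end Potential

section OptimalMap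

/-! ### The optimal map -/

open scoped RealInnerProductSpace ContDiff

variable {n : ℕ} {σ : Matrix (Fin n) (Fin n) ℝ} {γ T A l : ℝ} {φ : Vec n → ℝ}

/-- The gradient in space of a function of time and space. -/
noncomputable def spaceGrad (W : ℝ × Vec n → ℝ) (p : ℝ × Vec n) : Vec n :=
  gradient (fun z => W (p.1, z)) p.2

lemma inner_spaceGrad (W : ℝ × Vec n → ℝ) (p : ℝ × Vec n) (v : Vec n) :
    ⟪spaceGrad W p, v⟫ = fderiv ℝ (fun z => W (p.1, z)) p.2 v := inner_gradient_left

lemma spaceGrad_apply (W : ℝ × Vec n → ℝ) (p : ℝ × Vec n) (i : Fin n) :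
    spaceGrad W p i = fderiv ℝ (fun z => W (p.1, z)) p.2 (EuclideanSpace.single i 1) := by
  rw [← inner_spaceGrad, EuclideanSpace.inner_single_right]; simp

/-- The standing assumptions: a payoff with growth constants `A` and `l`, a positive definite
matrix, and the signs of the constants. The horizon `T` enters no field; it is a parameter so that
an assumption of this type determines the potential. -/
structure IsAdmissible (σ : Matrix (Fin n) (Fin n) ℝ) (γ T A l : ℝ) (φ : Vec n → ℝ) : Prop where
  payoff : IsPayoff A l φ
  posDef : σ.PosDef
  gamma_pos : 0 < γ
  l_nonneg : 0 ≤ l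
  A_nonneg : 0 ≤ A

/-- The times up to `T` for which the growth bound on the payoff makes the exponential moments
finite. Unlike `potDomain` it contains the horizon itself. -/
def admTimes (σ : Matrix (Fin n) (Fin n) ℝ) (γ T l : ℝ) : Set ℝ :=
  {t | t ≤ T ∧ γ * l * maxEigenvalue σ ^ 2 * (T - t) < 1}

variable (h : IsAdmissible σ γ T A l φ)

include h

lemma IsAdmissible.isBurgers : IsBurgersPotential σ γ
    (potDomain n (γ * l * maxEigenvalue σ ^ 2) T) (potential σ γ T φ) :=
  h.payoff.isBurgersPotential h.posDef h.gamma_pos h.l_nonneg h.A_nonneg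

lemma IsAdmissible.convexOn {t : ℝ} (ht : t ∈ admTimes σ γ T l) :
    ConvexOn ℝ univ fun z => potential σ γ T φ (t, z) :=
  h.payoff.convexOn_potential h.posDef h.gamma_pos h.l_nonneg h.A_nonneg ht.1 ht.2

lemma IsAdmissible.differentiable {t : ℝ} (ht : t ∈ admTimes σ γ T l) :
    Differentiable ℝ fun z => potential σ γ T φ (t, z) := by
  rcases ht.1.eq_or_lt with rfl | hlt
  · simp_rw [potential_terminal h.gamma_pos.ne']
    exact h.payoff.differentiable
  · intro z
    have := h.isBurgers.contDiffOn.differentiableAt_of_isOpen h.isBurgers.isOpen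
      (p := (t, z)) ⟨hlt, ht.2⟩
    exact this.comp z (by fun_prop : DifferentiableAt ℝ (fun z : Vec n => (t, z)) z)

lemma IsAdmissible.pd_eq_inner {p : ℝ × Vec n}
    (hp : p ∈ potDomain n (γ * l * maxEigenvalue σ ^ 2) T) (v : Vec n) :
    pd (0, v) (potential σ γ T φ) p = ⟪spaceGrad (potential σ γ T φ) p, v⟫ := by
  have hd := h.isBurgers.contDiffOn.differentiableAt_of_isOpen h.isBurgers.isOpen hp
  rw [inner_spaceGrad]
  have h1 : HasFDerivAt (fun z : Vec n => (p.1, z)) (ContinuousLinearMap.inr ℝ ℝ (Vec n)) p.2 :=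
    hasFDerivAt_prodMk_right p.1 p.2
  have h2 := hd.hasFDerivAt.comp p.2 h1
  simp only [Function.comp_def] at h2
  rw [h2.fderiv]
  rfl

lemma IsAdmissible.pd_dirS {p : ℝ × Vec n}
    (hp : p ∈ potDomain n (γ * l * maxEigenvalue σ ^ 2) T) (i : Fin n) :
    pd (dirS σ i) (potential σ γ T φ) p = act σ (spaceGrad (potential σ γ T φ) p) i := by
  rw [dirS, h.pd_eq_inner hp, ← inner_act _ _ h.posDef.isHermitian,
    EuclideanSpace.inner_single_right]
  simp

lemma IsAdmissible.drift_eq {p : ℝ × Vec n}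
    (hp : p ∈ potDomain n (γ * l * maxEigenvalue σ ^ 2) T) :
    drift σ (potential σ γ T φ) p = act σ (act σ (spaceGrad (potential σ γ T φ) p)) := by
  conv_rhs => rw [← sum_smul_single (act σ (spaceGrad (potential σ γ T φ) p))]
  rw [act, map_sum, drift]
  refine Finset.sum_congr rfl fun i _ => ?_
  rw [h.pd_dirS hp, map_smul]
  rfl

lemma IsAdmissible.invMap_eq {t : ℝ} (ht : t ∈ admTimes σ γ T l) (z : Vec n) :
    invMap σ γ T (potential σ γ T φ) (t, z) =
      z + (γ * (T - t)) • act σ (act σ (spaceGrad (potential σ γ T φ) (t, z))) := by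
  rcases ht.1.eq_or_lt with rfl | hlt
  · simp [invMap]
  · rw [invMap, h.drift_eq ⟨hlt, ht.2⟩]

lemma IsAdmissible.monotone_spaceGrad {t : ℝ} (ht : t ∈ admTimes σ γ T l) (z w : Vec n) :
    0 ≤ ⟪spaceGrad (potential σ γ T φ) (t, z) - spaceGrad (potential σ γ T φ) (t, w), z - w⟫ := by
  have h1 := add_fderiv_le_of_convexOn (h.convexOn ht) (h.differentiable ht z) (w - z)
  have h2 := add_fderiv_le_of_convexOn (h.convexOn ht) (h.differentiable ht w) (z - w)
  rw [add_sub_cancel] at h1 h2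
  rw [inner_sub_left, inner_spaceGrad, inner_spaceGrad]
  have h3 : fderiv ℝ (fun z => potential σ γ T φ (t, z)) z (w - z) =
      -fderiv ℝ (fun z => potential σ γ T φ (t, z)) z (z - w) := by
    rw [← map_neg, neg_sub]
  simp only
  linarith

/-- The inverse map expands distances measured through `σ⁻¹`, because the gradient of a convex
function is monotone. -/
lemma IsAdmissible.le_norm_invMap_sub {t : ℝ} (ht : t ∈ admTimes σ γ T l) (z w : Vec n) :
    ‖act σ⁻¹ (z - w)‖ ≤ ‖act σ⁻¹ (invMap σ γ T (potential σ γ T φ) (t, z) -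
      invMap σ γ T (potential σ γ T φ) (t, w))‖ := by
  have hdet : IsUnit σ.det := h.posDef.det_pos.ne'.isUnit
  set d := spaceGrad (potential σ γ T φ) (t, z) - spaceGrad (potential σ γ T φ) (t, w) with hd
  have e : act σ⁻¹ (invMap σ γ T (potential σ γ T φ) (t, z) -
      invMap σ γ T (potential σ γ T φ) (t, w)) =
      act σ⁻¹ (z - w) + (γ * (T - t)) • act σ d := by
    have e1 : invMap σ γ T (potential σ γ T φ) (t, z) - invMap σ γ T (potential σ γ T φ) (t, w) =
        (z - w) + (γ * (T - t)) • act σ (act σ d) := by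
      rw [h.invMap_eq ht, h.invMap_eq ht, hd, act_sub, act_sub, smul_sub]
      abel
    rw [e1, act_add, act_smul, act_inv_act _ hdet]
  have h1 : ‖act σ⁻¹ (z - w)‖ ^ 2 ≤
      ⟪act σ⁻¹ (z - w) + (γ * (T - t)) • act σ d, act σ⁻¹ (z - w)⟫ := by
    rw [inner_add_left, real_inner_self_eq_norm_sq, real_inner_smul_left,
      inner_act _ _ h.posDef.isHermitian, act_act_inv _ hdet]
    have := h.monotone_spaceGrad ht z w
    have hT := mul_nonneg (mul_nonneg h.gamma_pos.le (sub_nonneg.2 ht.1)) this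
    linarith
  have h2 := h1.trans (real_inner_le_norm _ _)
  rw [e]
  rcases (norm_nonneg (act σ⁻¹ (z - w))).eq_or_lt with h0 | h0
  · rw [← h0]; exact norm_nonneg _
  · rw [sq] at h2
    exact le_of_mul_le_mul_right h2 h0

lemma IsAdmissible.invMap_injective {t : ℝ} (ht : t ∈ admTimes σ γ T l) {z w : Vec n}
    (hzw : invMap σ γ T (potential σ γ T φ) (t, z) = invMap σ γ T (potential σ γ T φ) (t, w)) :
    z = w := by
  have hdet : IsUnit σ.det := h.posDef.det_pos.ne'.isUnit
  have h1 := h.le_norm_invMap_sub ht z w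
  rw [hzw, sub_self, show act σ⁻¹ (0 : Vec n) = 0 from map_zero _, norm_zero] at h1
  have h2 : act σ⁻¹ (z - w) = 0 := norm_le_zero_iff.1 h1
  have h3 := congrArg (act σ) h2
  rw [act_act_inv _ hdet, show act σ (0 : Vec n) = 0 from map_zero _] at h3
  exact sub_eq_zero.1 h3

lemma IsAdmissible.norm_le_act_inv (x : Vec n) :
    ‖x‖ ≤ maxEigenvalue σ * ‖act σ⁻¹ x‖ := by
  have := norm_act_le (act σ⁻¹ x) h.posDef
  rwa [act_act_inv _ h.posDef.det_pos.ne'.isUnit] at this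

omit h in
/-- The penalized potential, to be minimized in `z`. -/
noncomputable def penalized (σ : Matrix (Fin n) (Fin n) ℝ) (γ T : ℝ) (φ : Vec n → ℝ) (t : ℝ)
    (ξ z : Vec n) : ℝ :=
  potential σ γ T φ (t, z) + 1 / (2 * γ * (T - t)) * ‖act σ⁻¹ (ξ - z)‖ ^ 2

lemma IsAdmissible.strongConvexOn_penalized (hn : 1 ≤ n) {t : ℝ} (ht : t ∈ admTimes σ γ T l)
    (htT : t < T) (ξ : Vec n) :
    StrongConvexOn univ (2 * (1 / (2 * γ * (T - t)) / maxEigenvalue σ ^ 2))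
      (penalized σ γ T φ t ξ) := by
  have hΛ := maxEigenvalue_pos hn h.posDef
  have hγ := h.gamma_pos
  have hTt : 0 < T - t := sub_pos.2 htT
  set c := 1 / (2 * γ * (T - t)) with hc
  have hcpos : 0 < c := by positivity
  refine ⟨convex_univ, fun x _ y _ a b ha hb hab => ?_⟩
  have h1 := (h.convexOn ht).2 (mem_univ x) (mem_univ y) ha hb hab
  have e : act σ⁻¹ (ξ - (a • x + b • y)) = a • act σ⁻¹ (ξ - x) + b • act σ⁻¹ (ξ - y) := by
    rw [← act_smul, ← act_smul, ← act_add]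
    congr 1
    rw [← eq_sub_iff_add_eq] at hab; rw [hab]; module
  -- the defect of convexity of the squared norm
  have h2 : ‖a • act σ⁻¹ (ξ - x) + b • act σ⁻¹ (ξ - y)‖ ^ 2 = a * ‖act σ⁻¹ (ξ - x)‖ ^ 2 +
      b * ‖act σ⁻¹ (ξ - y)‖ ^ 2 - a * b * ‖act σ⁻¹ (x - y)‖ ^ 2 := by
    have : act σ⁻¹ (x - y) = act σ⁻¹ (ξ - y) - act σ⁻¹ (ξ - x) := by
      rw [← act_sub]; congr 1; abel
    rw [this]
    generalize act σ⁻¹ (ξ - x) = X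
    generalize act σ⁻¹ (ξ - y) = Y
    rw [norm_add_sq_real, norm_sub_sq_real, norm_smul, norm_smul, mul_pow, mul_pow,
      Real.norm_of_nonneg ha, Real.norm_of_nonneg hb, real_inner_smul_left, real_inner_smul_right,
      real_inner_comm X Y]
    rw [← eq_sub_iff_add_eq] at hab; rw [hab]; ring
  have h3 : ‖x - y‖ ^ 2 / maxEigenvalue σ ^ 2 ≤ ‖act σ⁻¹ (x - y)‖ ^ 2 := by
    rw [div_le_iff₀ (by positivity), mul_comm, ← mul_pow]
    exact pow_le_pow_left₀ (norm_nonneg _) (h.norm_le_act_inv _) 2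
  have h4 := mul_le_mul_of_nonneg_left h3 (mul_nonneg (mul_nonneg ha hb) hcpos.le)
  simp only [penalized, smul_eq_mul, e, h2, ← hc] at h1 ⊢
  have h5 : a * b * (2 * (c / maxEigenvalue σ ^ 2) / 2 * ‖x - y‖ ^ 2) =
      a * b * c * (‖x - y‖ ^ 2 / maxEigenvalue σ ^ 2) := by ring
  rw [h5]
  linarith

lemma IsAdmissible.hasFDerivAt_penalized {t : ℝ} (ht : t ∈ admTimes σ γ T l) (ξ z : Vec n) :
    ∃ L : Vec n →L[ℝ] ℝ, HasFDerivAt (penalized σ γ T φ t ξ) L z ∧ ∀ v, L v =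
      ⟪spaceGrad (potential σ γ T φ) (t, z), v⟫ -
        1 / (γ * (T - t)) * ⟪act σ⁻¹ (act σ⁻¹ (ξ - z)), v⟫ := by
  have h1 : HasFDerivAt (fun z => act σ⁻¹ (ξ - z)) (-(Matrix.toEuclideanCLM (𝕜 := ℝ) σ⁻¹)) z := by
    have := (Matrix.toEuclideanCLM (𝕜 := ℝ) σ⁻¹).hasFDerivAt.comp z
      ((hasFDerivAt_id z).const_sub ξ)
    simpa using! this
  have h2 := (h.differentiable ht z).hasFDerivAt.add
    (h1.norm_sq.const_mul (1 / (2 * γ * (T - t))))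
  refine ⟨_, h2, fun v => ?_⟩
  rw [inner_spaceGrad, inner_act _ _ h.posDef.isHermitian.inv]
  simp [act, inner_sub_left]
  ring

/-- The penalized potential is coercive and hence has a minimizer; its first-order condition says
that the inverse map sends the minimizer to `ξ`. -/
lemma IsAdmissible.exists_isMin_penalized (hn : 1 ≤ n) {t : ℝ} (ht : t ∈ admTimes σ γ T l)
    (htT : t < T) (ξ : Vec n) :
    ∃ z, invMap σ γ T (potential σ γ T φ) (t, z) = ξ ∧
      ∀ w, w ≠ z → penalized σ γ T φ t ξ z < penalized σ γ T φ t ξ w := by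
  have hΛ := maxEigenvalue_pos hn h.posDef
  have hγ := h.gamma_pos
  have hTt : 0 < T - t := sub_pos.2 htT
  have hdet : IsUnit σ.det := h.posDef.det_pos.ne'.isUnit
  have hcont : Continuous (penalized σ γ T φ t ξ) := continuous_iff_continuousAt.2 fun z => by
    obtain ⟨L, hL, -⟩ := h.hasFDerivAt_penalized ht ξ z
    exact hL.continuousAt
  set c := 1 / (2 * γ * (T - t)) / maxEigenvalue σ ^ 2 with hc
  have hcpos : 0 < c := by positivity
  set g := ‖fderiv ℝ (fun z => potential σ γ T φ (t, z)) 0‖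
  -- the tangent plane of the potential at the origin and the quadratic penalty give linear growth
  have hlow (z : Vec n) : potential σ γ T φ (t, 0) - (g + 1) * ‖ξ‖ - (g + 1) ^ 2 / (4 * c) + ‖z‖ ≤
      penalized σ γ T φ t ξ z := by
    have h1 := add_fderiv_le_of_convexOn (h.convexOn ht) (h.differentiable ht 0) z
    have h2 : -(g * ‖z‖) ≤ fderiv ℝ (fun z => potential σ γ T φ (t, z)) 0 z :=
      (abs_le.1 ((fderiv ℝ (fun z => potential σ γ T φ (t, z)) 0).le_opNorm z)).1
    have h3 : c * ‖ξ - z‖ ^ 2 ≤ 1 / (2 * γ * (T - t)) * ‖act σ⁻¹ (ξ - z)‖ ^ 2 := by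
      rw [hc, div_mul_eq_mul_div, mul_div_assoc]
      refine mul_le_mul_of_nonneg_left ?_ (by positivity)
      rw [div_le_iff₀ (by positivity), mul_comm, ← mul_pow]
      exact pow_le_pow_left₀ (norm_nonneg _) (h.norm_le_act_inv _) 2
    have h4 : ‖z‖ ≤ ‖ξ‖ + ‖ξ - z‖ := by
      have := norm_sub_le ξ (ξ - z)
      rwa [sub_sub_cancel] at this
    have h5 : (g + 1) * ‖ξ - z‖ ≤ c * ‖ξ - z‖ ^ 2 + (g + 1) ^ 2 / (4 * c) := by
      have : c * ‖ξ - z‖ ^ 2 + (g + 1) ^ 2 / (4 * c) - (g + 1) * ‖ξ - z‖ =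
          (2 * c * ‖ξ - z‖ - (g + 1)) ^ 2 / (4 * c) := by field_simp; ring
      have h0 : 0 ≤ (2 * c * ‖ξ - z‖ - (g + 1)) ^ 2 / (4 * c) := by positivity
      linarith
    have h6 : (g + 1) * ‖z‖ ≤ (g + 1) * (‖ξ‖ + ‖ξ - z‖) := by
      gcongr
    rw [zero_add] at h1
    rw [penalized]
    linarith
  obtain ⟨z, hz⟩ := hcont.exists_forall_le
    (tendsto_atTop_mono hlow (tendsto_atTop_add_const_left _ _ tendsto_norm_cocompact_atTop))
  refine ⟨z, ?_, fun w hw => ?_⟩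
  · obtain ⟨L, hL, hLv⟩ := h.hasFDerivAt_penalized ht ξ z
    have hmin : IsLocalMin (penalized σ γ T φ t ξ) z := Eventually.of_forall hz
    have hL0 : L = 0 := hmin.hasFDerivAt_eq_zero hL
    have h1 : spaceGrad (potential σ γ T φ) (t, z) =
        (1 / (γ * (T - t))) • act σ⁻¹ (act σ⁻¹ (ξ - z)) := by
      refine ext_inner_right ℝ fun v => ?_
      have := hLv v
      rw [hL0] at this
      rw [real_inner_smul_left]
      simp only [zero_apply] at this
      linarith
    rw [h.invMap_eq ht, h1, act_smul, act_smul, act_act_inv _ hdet, act_act_inv _ hdet, smul_smul,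
      mul_one_div_cancel (by positivity), one_smul, add_sub_cancel]
  · refine lt_of_le_of_ne (hz w) fun heq => hw ?_
    exact ((h.strongConvexOn_penalized hn ht htT ξ).strictConvexOn (by positivity)).eq_of_isMinOn
      (fun x _ => heq ▸ hz x) (fun x _ => hz x) (mem_univ _) (mem_univ _)

omit h in
/-- The optimal map, the inverse of `invMap` in space. It is defined by choice, so that it makes
sense for all times; the choice is unique for the times in `admTimes`. -/
noncomputable def optMap (σ : Matrix (Fin n) (Fin n) ℝ) (γ T : ℝ) (φ : Vec n → ℝ)
    (p : ℝ × Vec n) : Vec n :=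
  Classical.epsilon fun z => invMap σ γ T (potential σ γ T φ) (p.1, z) = p.2

lemma IsAdmissible.invMap_optMap (hn : 1 ≤ n) {p : ℝ × Vec n} (ht : p.1 ∈ admTimes σ γ T l) :
    invMap σ γ T (potential σ γ T φ) (p.1, optMap σ γ T φ p) = p.2 := by
  have hex : ∃ z, invMap σ γ T (potential σ γ T φ) (p.1, z) = p.2 := by
    rcases ht.1.eq_or_lt with hT | hlt
    · exact ⟨p.2, by simp [invMap, hT]⟩
    · obtain ⟨z, hz, -⟩ := h.exists_isMin_penalized hn ht hlt p.2
      exact ⟨z, hz⟩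
  exact Classical.epsilon_spec hex

lemma IsAdmissible.optMap_eq (hn : 1 ≤ n) {t : ℝ} (ht : t ∈ admTimes σ γ T l) {ξ z : Vec n}
    (hz : invMap σ γ T (potential σ γ T φ) (t, z) = ξ) : optMap σ γ T φ (t, ξ) = z :=
  h.invMap_injective ht ((h.invMap_optMap hn (p := (t, ξ)) ht).trans hz.symm)

/-- The distance from any `z` to the value of the optimal map at `ξ` is controlled by the distance
from `Ψ(t, z)` to `ξ`, because the inverse map is expanding. -/
lemma IsAdmissible.norm_optMap_sub_le (hn : 1 ≤ n) {p : ℝ × Vec n} (ht : p.1 ∈ admTimes σ γ T l)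
    (z : Vec n) :
    ‖optMap σ γ T φ p - z‖ ≤ maxEigenvalue σ *
      ‖act σ⁻¹ (p.2 - invMap σ γ T (potential σ γ T φ) (p.1, z))‖ := by
  have h1 := h.le_norm_invMap_sub ht (optMap σ γ T φ p) z
  rw [h.invMap_optMap hn ht] at h1
  exact (h.norm_le_act_inv _).trans
    (mul_le_mul_of_nonneg_left h1 (maxEigenvalue_pos hn h.posDef).le)

section Limits

variable {ι : Type*} {𝓕 : Filter ι} [𝓕.IsCountablyGenerated] {φs : ι → Vec n → ℝ}
  {p : ι → ℝ × Vec n} {p₀ : ℝ × Vec n}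

lemma IsAdmissible.tendsto_spaceGrad (hφs : ∀ᶠ i in 𝓕, IsAdmissible σ γ T A l (φs i))
    (hφ : ∀ (x : ι → Vec n) (x₀ : Vec n), Tendsto x 𝓕 (𝓝 x₀) →
      Tendsto (fun i => φs i (x i)) 𝓕 (𝓝 (φ x₀)))
    (hp : Tendsto p 𝓕 (𝓝 p₀)) (hpT : ∀ᶠ i in 𝓕, (p i).1 ∈ admTimes σ γ T l)
    (hp₀ : p₀.1 ∈ admTimes σ γ T l) :
    Tendsto (fun i => spaceGrad (potential σ γ T (φs i)) (p i)) 𝓕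
      (𝓝 (spaceGrad (potential σ γ T φ) p₀)) := by
  have hlim (v : Vec n) : Tendsto (fun i => potential σ γ T (φs i) ((p i).1, (p i).2 + v)) 𝓕
      (𝓝 (potential σ γ T φ (p₀.1, p₀.2 + v))) := by
    refine tendsto_potential (hφs.mono fun i hi => hi.payoff) h.payoff hφ h.posDef h.gamma_pos
      h.l_nonneg h.A_nonneg ?_ hp₀.1 hp₀.2
    exact ((continuous_fst.prodMk (continuous_snd.add continuous_const)).tendsto p₀).comp hp
  have hd := tendsto_fderiv_of_convexOn (g := fun i z => potential σ γ T (φs i) ((p i).1, z))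
    (g₀ := fun z => potential σ γ T φ (p₀.1, z))
    (by filter_upwards [hφs, hpT] with i hi ht using hi.convexOn ht)
    (by filter_upwards [hφs, hpT] with i hi ht using hi.differentiable ht _)
    (h.differentiable hp₀ _) hlim
  have hc : Tendsto (fun i => (spaceGrad (potential σ γ T (φs i)) (p i)).ofLp) 𝓕
      (𝓝 (spaceGrad (potential σ γ T φ) p₀).ofLp) := by
    refine tendsto_pi_nhds.2 fun j => ?_
    simp only [spaceGrad_apply]
    exact hd _
  exact ((PiLp.continuous_toLp 2 _).tendsto _).comp hc

/-- Continuity of the optimal map, jointly in the payoff, in time up to the horizon, and in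
space. -/
lemma IsAdmissible.tendsto_optMap (hn : 1 ≤ n)
    (hφs : ∀ᶠ i in 𝓕, IsAdmissible σ γ T A l (φs i))
    (hφ : ∀ (x : ι → Vec n) (x₀ : Vec n), Tendsto x 𝓕 (𝓝 x₀) →
      Tendsto (fun i => φs i (x i)) 𝓕 (𝓝 (φ x₀)))
    (hp : Tendsto p 𝓕 (𝓝 p₀)) (hpT : ∀ᶠ i in 𝓕, (p i).1 ∈ admTimes σ γ T l)
    (hp₀ : p₀.1 ∈ admTimes σ γ T l) :
    Tendsto (fun i => optMap σ γ T (φs i) (p i)) 𝓕 (𝓝 (optMap σ γ T φ p₀)) := by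
  set z₀ := optMap σ γ T φ p₀ with hz₀
  have hp1 : Tendsto (fun i => (p i).1) 𝓕 (𝓝 p₀.1) := (continuous_fst.tendsto p₀).comp hp
  have hp2 : Tendsto (fun i => (p i).2) 𝓕 (𝓝 p₀.2) := (continuous_snd.tendsto p₀).comp hp
  have hG := h.tendsto_spaceGrad (p := fun i => ((p i).1, z₀)) (p₀ := (p₀.1, z₀)) hφs hφ
    (hp1.prodMk_nhds tendsto_const_nhds) hpT hp₀
  have hΨ : Tendsto (fun i => invMap σ γ T (potential σ γ T (φs i)) ((p i).1, z₀)) 𝓕 (𝓝 p₀.2) := by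
    rw [← h.invMap_optMap hn hp₀, ← hz₀, h.invMap_eq hp₀]
    have h1 : Tendsto (fun i => z₀ + (γ * (T - (p i).1)) •
        act σ (act σ (spaceGrad (potential σ γ T (φs i)) ((p i).1, z₀)))) 𝓕
        (𝓝 (z₀ + (γ * (T - p₀.1)) •
          act σ (act σ (spaceGrad (potential σ γ T φ) (p₀.1, z₀))))) := by
      refine tendsto_const_nhds.add (((hp1.const_sub T).const_mul γ).smul ?_)
      exact ((by fun_prop : Continuous fun x : Vec n => act σ (act σ x)).tendsto _).comp hG
    refine h1.congr' ?_
    filter_upwards [hφs, hpT] with i hi ht using (hi.invMap_eq ht z₀).symm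
  have hb : Tendsto (fun i => maxEigenvalue σ *
      ‖act σ⁻¹ ((p i).2 - invMap σ γ T (potential σ γ T (φs i)) ((p i).1, z₀))‖) 𝓕 (𝓝 0) := by
    have := ((by fun_prop : Continuous fun x : Vec n =>
      maxEigenvalue σ * ‖act σ⁻¹ x‖).tendsto _).comp (hp2.sub hΨ)
    simpa [Function.comp_def, act] using this
  rw [tendsto_iff_norm_sub_tendsto_zero]
  refine squeeze_zero' (Eventually.of_forall fun _ => norm_nonneg _) ?_ hb
  filter_upwards [hφs, hpT] with i hi ht using hi.norm_optMap_sub_le hn ht z₀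

end Limits

/-- The differential of the inverse map is injective, being expanding. -/
lemma IsAdmissible.pd_invMap_injective {p : ℝ × Vec n}
    (hp : p ∈ potDomain n (γ * l * maxEigenvalue σ ^ 2) T) {v : Vec n}
    (hv : pd (0, v) (invMap σ γ T (potential σ γ T φ)) p = 0) : v = 0 := by
  have hdet : IsUnit σ.det := h.posDef.det_pos.ne'.isUnit
  have hd := (h.isBurgers.contDiffOn_invMap (T := T)).differentiableAt_of_isOpen
    h.isBurgers.isOpen hp
  have h1 := (hasDerivAt_line hd (0, v)).tendsto_slope_zero_right
  have h2 := ((by fun_prop : Continuous fun x : Vec n => ‖act σ⁻¹ x‖).tendsto _).comp h1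
  have h3 : ‖act σ⁻¹ v‖ ≤ ‖act σ⁻¹ (pd (0, v) (invMap σ γ T (potential σ γ T φ)) p)‖ := by
    refine ge_of_tendsto h2 ?_
    filter_upwards [self_mem_nhdsWithin] with τ hτ
    have hτ' : (0 : ℝ) < τ := hτ
    have h4 := h.le_norm_invMap_sub ⟨hp.1.le, hp.2⟩ (p.2 + τ • v) p.2
    rw [add_sub_cancel_left, act_smul, norm_smul, Real.norm_of_nonneg hτ'.le] at h4
    have e1 : p + τ • ((0 : ℝ), v) = (p.1, p.2 + τ • v) := by ext <;> simp
    simp only [Function.comp_apply, zero_add, zero_smul, add_zero, e1]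
    rw [act_smul, norm_smul, norm_inv, Real.norm_of_nonneg hτ'.le, le_inv_mul_iff₀ hτ']
    exact h4
  rw [hv, show act σ⁻¹ (0 : Vec n) = 0 from map_zero _, norm_zero] at h3
  have h5 := congrArg (act σ) (norm_le_zero_iff.1 h3)
  rwa [act_act_inv _ hdet, show act σ (0 : Vec n) = 0 from map_zero _] at h5

/-- The optimal map is smooth before the horizon, by the inverse function theorem. -/
lemma IsAdmissible.contDiffOn_optMap (hn : 1 ≤ n) :
    ContDiffOn ℝ ∞ (optMap σ γ T φ) (potDomain n (γ * l * maxEigenvalue σ ^ 2) T) := by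
  have hD := h.isBurgers.isOpen
  intro q hq
  set p : ℝ × Vec n := (q.1, optMap σ γ T φ q) with hp
  have hpD : p ∈ potDomain n (γ * l * maxEigenvalue σ ^ 2) T := hq
  have hpq : shear σ γ T (potential σ γ T φ) p = q := by
    ext1
    · rfl
    · exact h.invMap_optMap hn ⟨hq.1.le, hq.2⟩
  have hf : ContDiffAt ℝ ∞ (shear σ γ T (potential σ γ T φ)) p :=
    (contDiffOn_fst.prodMk (h.isBurgers.contDiffOn_invMap (T := T))).contDiffAt
      (hD.mem_nhds hpD)
  have hf' := h.isBurgers.hasFDerivAt_shear (T := T) hpD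
  set L := (ContinuousLinearMap.fst ℝ ℝ (Vec n)).prod
    (fderiv ℝ (invMap σ γ T (potential σ γ T φ)) p) with hL
  have hinj : Function.Injective L := by
    refine (injective_iff_map_eq_zero L).2 fun x hx => ?_
    have hx1 : x.1 = 0 := congrArg Prod.fst hx
    have hx2 : fderiv ℝ (invMap σ γ T (potential σ γ T φ)) p x = 0 := congrArg Prod.snd hx
    have hx' : x = (0, x.2) := Prod.ext hx1 rfl
    rw [hx'] at hx2
    rw [hx', h.pd_invMap_injective hpD hx2]
    rfl
  set L' : (ℝ × Vec n) ≃L[ℝ] (ℝ × Vec n) :=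
    (LinearEquiv.ofInjectiveEndo L.toLinearMap hinj).toContinuousLinearEquiv with hL'
  have hLL' : (L' : (ℝ × Vec n) →L[ℝ] (ℝ × Vec n)) = L :=
    ContinuousLinearMap.ext fun _ => rfl
  rw [← hLL'] at hf'
  have hs := hf.hasStrictFDerivAt' hf' (by simp)
  have hg := hf.to_localInverse hf' (by simp)
  have hg0 := hf.localInverse_apply_image hf' (by simp)
  have hr : ∀ᶠ y in 𝓝 (shear σ γ T (potential σ γ T φ) p),
      shear σ γ T (potential σ γ T φ) (hf.localInverse hf' (by simp) y) = y :=
    hs.eventually_right_inverse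
  rw [hpq] at hg hg0 hr
  refine (hg.snd.congr_of_eventuallyEq ?_).contDiffWithinAt
  have hmem : ∀ᶠ y in 𝓝 q, hf.localInverse hf' (by simp) y ∈
      potDomain n (γ * l * maxEigenvalue σ ^ 2) T :=
    hg.continuousAt.eventually_mem (hD.mem_nhds (by rw [hg0]; exact hpD))
  filter_upwards [hr, hmem] with y hy hyD
  have hy1 : (hf.localInverse hf' (by simp) y).1 = y.1 := by
    have := congrArg Prod.fst hy; exact this
  have hy2 : invMap σ γ T (potential σ γ T φ) (hf.localInverse hf' (by simp) y) = y.2 := by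
    have := congrArg Prod.snd hy; exact this
  have ht : y.1 ∈ admTimes σ γ T l := by rw [← hy1]; exact ⟨hyD.1.le, hyD.2⟩
  exact h.optMap_eq hn ht (by rw [← hy2, ← hy1])

end OptimalMap

section Regularity

/-! ### Classical regularity from joint smoothness -/

open scoped ContDiff

variable {n : ℕ} {T : ℝ} {u : ℝ → Vec n → ℝ} {U : ℝ × Vec n → ℝ} {D : Set (ℝ × Vec n)}

/-- `u` coincides on `[0,T) × ℝⁿ` with a function `U` that is smooth on an open neighbourhood. -/
structure IsSmoothExt (T : ℝ) (D : Set (ℝ × Vec n)) (u : ℝ → Vec n → ℝ) (U : ℝ × Vec n → ℝ) :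
    Prop where
  isOpen : IsOpen D
  contDiffOn : ContDiffOn ℝ ∞ U D
  mem : ∀ t ∈ Ico 0 T, ∀ x, (t, x) ∈ D
  eq : ∀ t ∈ Ico 0 T, ∀ x, u t x = U (t, x)

lemma IsSmoothExt.hasDerivWithinAt (h : IsSmoothExt T D u U) {t : ℝ} (ht : t ∈ Ico 0 T)
    (x : Vec n) : HasDerivWithinAt (fun s => u s x) (pd (1, 0) U (t, x)) (Ico 0 T) t := by
  have hd := (h.contDiffOn.differentiableAt_of_isOpen h.isOpen (h.mem t ht x)).hasFDerivAt
  have h1 : HasDerivAt (fun s : ℝ => (s, x)) ((1 : ℝ), (0 : Vec n)) t :=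
    (hasDerivAt_id t).prodMk (hasDerivAt_const t x)
  exact (hd.comp_hasDerivAt t h1).hasDerivWithinAt.congr (fun s hs => h.eq s hs x) (h.eq t ht x)

lemma IsSmoothExt.timeDeriv_eq (h : IsSmoothExt T D u U) {t : ℝ} (ht : t ∈ Ico 0 T)
    (x : Vec n) : timeDeriv T u t x = pd (1, 0) U (t, x) :=
  (h.hasDerivWithinAt ht x).derivWithin (uniqueDiffOn_Ico 0 T t ht)

lemma fderiv_slice {t : ℝ} {x : Vec n} (hd : DifferentiableAt ℝ U (t, x)) (v : Vec n) :
    fderiv ℝ (fun y => U (t, y)) x v = pd (0, v) U (t, x) := by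
  have h2 := hd.hasFDerivAt.comp x (hasFDerivAt_prodMk_right t x)
  simp only [Function.comp_def] at h2
  rw [h2.fderiv]
  rfl

lemma IsSmoothExt.partialDeriv_eq (h : IsSmoothExt T D u U) {t : ℝ} (ht : t ∈ Ico 0 T)
    (i : Fin n) (x : Vec n) : partialDeriv i (u t) x = pd (dirX i) U (t, x) := by
  rw [partialDeriv, show u t = fun y => U (t, y) from funext (h.eq t ht),
    fderiv_slice (h.contDiffOn.differentiableAt_of_isOpen h.isOpen (h.mem t ht x)), dirX]

lemma IsSmoothExt.hessian_eq (h : IsSmoothExt T D u U) {t : ℝ} (ht : t ∈ Ico 0 T)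
    (i j : Fin n) (x : Vec n) :
    hessian (u t) x i j = pd (dirX i) (pd (dirX j) U) (t, x) := by
  have h1 : partialDeriv j (u t) = fun y => pd (dirX j) U (t, y) :=
    funext (h.partialDeriv_eq ht j)
  have hd := (contDiffOn_pd h.isOpen h.contDiffOn (dirX j)).differentiableAt_of_isOpen h.isOpen
    (h.mem t ht x)
  rw [hessian, Matrix.of_apply, h1, partialDeriv, fderiv_slice hd]
  rfl

lemma IsSmoothExt.isC12 (h : IsSmoothExt T D u U) : IsC12 T u := by
  have hsub : Ico 0 T ×ˢ (univ : Set (Vec n)) ⊆ D := fun p hp => h.mem p.1 hp.1 p.2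
  have h1 (v) := contDiffOn_pd h.isOpen h.contDiffOn v
  refine ⟨fun t ht x => (h.hasDerivWithinAt ht x).differentiableWithinAt, fun t ht => ?_, ?_, ?_,
    fun i => ?_, ?_⟩
  · rw [show u t = fun y => U (t, y) from funext (h.eq t ht)]
    refine contDiff_iff_contDiffAt.2 fun x => ?_
    have h2 : ContDiffAt ℝ ∞ U (t, x) := h.contDiffOn.contDiffAt (h.isOpen.mem_nhds (h.mem t ht x))
    exact (h2.comp x (contDiff_prodMk_right t).contDiffAt).of_le
      (WithTop.coe_le_coe.2 (le_top : (2 : ℕ∞) ≤ ⊤))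
  · exact (h.contDiffOn.continuousOn.mono hsub).congr fun p hp => h.eq p.1 hp.1 p.2
  · exact ((h1 _).continuousOn.mono hsub).congr fun p hp => h.timeDeriv_eq hp.1 p.2
  · exact ((h1 _).continuousOn.mono hsub).congr fun p hp => h.partialDeriv_eq hp.1 i p.2
  · refine continuousOn_pi.2 fun i => continuousOn_pi.2 fun j => ?_
    exact ((contDiffOn_pd h.isOpen (h1 _) _).continuousOn.mono hsub).congr
      fun p hp => h.hessian_eq hp.1 i j p.2

lemma pd_eq_sum (p : ℝ × Vec n) (w : Vec n) {F : Type*} [NormedAddCommGroup F] [NormedSpace ℝ F]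
    (H : ℝ × Vec n → F) : pd (0, w) H p = ∑ j, w j • pd (dirX j) H p := by
  have : ((0 : ℝ), w) = ∑ j, w j • dirX j := by
    ext j
    · simp [dirX, Prod.fst_sum]
    · simp [dirX, Prod.snd_sum, Pi.single_apply]
  rw [this, pd, map_sum]
  simp [pd]

/-- The operator `parabolicOp` in terms of second derivatives along the columns of
`(Dχ)⁻¹ σ`. -/
lemma IsSmoothExt.parabolicOp_eq (h : IsSmoothExt T D u U) {σ : Matrix (Fin n) (Fin n) ℝ}
    {χ : ℝ → Vec n → Vec n} {t : ℝ} (ht : t ∈ Ico 0 T) (ξ : Vec n) {b : Fin n → Vec n}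
    (hb : ∀ i k, ((jacobian (χ t) ξ)⁻¹ * σ) k i = b i k) :
    parabolicOp σ T χ u t ξ =
      pd (1, 0) U (t, ξ) + 1 / 2 * ∑ i, pd (0, b i) (pd (0, b i) U) (t, ξ) := by
  have hmem := h.mem t ht ξ
  have h1 (i : Fin n) : pd (0, b i) (pd (0, b i) U) (t, ξ) =
      ∑ m, ∑ k, b i m * b i k * hessian (u t) ξ m k := by
    simp_rw [h.hessian_eq ht]
    rw [pd_eq_sum]
    refine Finset.sum_congr rfl fun m _ => ?_
    rw [pd_comm h.isOpen h.contDiffOn hmem, pd_eq_sum, smul_eq_mul, Finset.mul_sum]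
    refine Finset.sum_congr rfl fun k _ => ?_
    rw [pd_comm h.isOpen h.contDiffOn hmem, smul_eq_mul, mul_assoc]
  rw [parabolicOp, h.timeDeriv_eq ht]
  congr 2
  have h2 : σ.transpose * ((jacobian (χ t) ξ)⁻¹).transpose * hessian (u t) ξ *
      (jacobian (χ t) ξ)⁻¹ * σ = ((jacobian (χ t) ξ)⁻¹ * σ).transpose * hessian (u t) ξ *
      ((jacobian (χ t) ξ)⁻¹ * σ) := by
    rw [Matrix.transpose_mul]
    simp only [Matrix.mul_assoc]
  rw [h2, Matrix.trace]
  refine Finset.sum_congr rfl fun i _ => ?_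
  rw [h1, Matrix.diag_apply, Matrix.mul_apply, Finset.sum_comm]
  refine Finset.sum_congr rfl fun k _ => ?_
  rw [Matrix.mul_apply, Finset.sum_mul]
  refine Finset.sum_congr rfl fun m _ => ?_
  rw [Matrix.transpose_apply, hb, hb]
  ring

end Regularity

section System

/-! ### The system of equations -/

open scoped RealInnerProductSpace ContDiff

variable {n : ℕ} {σ : Matrix (Fin n) (Fin n) ℝ} {γ T A l : ℝ} {φ : Vec n → ℝ}

/-- The space-time map `(t, ξ) ↦ (t, χ(t, ξ))`, inverse to `shear`. -/
noncomputable def unshear (σ : Matrix (Fin n) (Fin n) ℝ) (γ T : ℝ) (φ : Vec n → ℝ)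
    (q : ℝ × Vec n) : ℝ × Vec n :=
  (q.1, optMap σ γ T φ q)

variable (h : IsAdmissible σ γ T A l φ) (hn : 1 ≤ n)
include h hn

lemma IsAdmissible.shear_unshear {q : ℝ × Vec n}
    (hq : q ∈ potDomain n (γ * l * maxEigenvalue σ ^ 2) T) :
    shear σ γ T (potential σ γ T φ) (unshear σ γ T φ q) = q :=
  Prod.ext rfl (h.invMap_optMap hn ⟨hq.1.le, hq.2⟩)

lemma IsAdmissible.unshear_shear {p : ℝ × Vec n}
    (hp : p ∈ potDomain n (γ * l * maxEigenvalue σ ^ 2) T) :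
    unshear σ γ T φ (shear σ γ T (potential σ γ T φ) p) = p :=
  Prod.ext rfl (h.optMap_eq hn (t := p.1) ⟨hp.1.le, hp.2⟩ rfl)

lemma IsAdmissible.contDiffOn_unshear :
    ContDiffOn ℝ ∞ (unshear σ γ T φ) (potDomain n (γ * l * maxEigenvalue σ ^ 2) T) :=
  contDiffOn_fst.prodMk (h.contDiffOn_optMap hn)

/-- The chain rule for `χ(t, Ψ(t, z)) = z`. -/
lemma IsAdmissible.pd_optMap_pd_invMap {p : ℝ × Vec n}
    (hp : p ∈ potDomain n (γ * l * maxEigenvalue σ ^ 2) T) (v : Vec n) :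
    pd (0, pd (0, v) (invMap σ γ T (potential σ γ T φ)) p) (optMap σ γ T φ)
      (shear σ γ T (potential σ γ T φ) p) = v := by
  have hD := h.isBurgers.isOpen
  have h1 : EqOn (fun p => optMap σ γ T φ (shear σ γ T (potential σ γ T φ) p)) (fun p => p.2)
      (potDomain n (γ * l * maxEigenvalue σ ^ 2) T) :=
    fun p hp => congrArg Prod.snd (h.unshear_shear hn hp)
  have h2 := pd_congr (v := ((0 : ℝ), v)) hD h1 hp
  have h3 := h.isBurgers.hasFDerivAt_shear (T := T) hp
  rw [pd_snd, pd_comp ((h.contDiffOn_optMap hn).differentiableAt_of_isOpen hD (by exact hp))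
    h3.differentiableAt] at h2
  have h4 : pd ((0 : ℝ), v) (shear σ γ T (potential σ γ T φ)) p =
      (0, pd (0, v) (invMap σ γ T (potential σ γ T φ)) p) := by
    rw [pd, h3.fderiv]; rfl
  rwa [h4] at h2

variable {χ : ℝ → Vec n → Vec n}

/-- The Jacobian of the optimal map is invertible, and its inverse carries the columns of `σ` to
the derivatives of the inverse map along these columns. -/
lemma IsAdmissible.jacobian_inv_mul (hχ : ∀ t ∈ Ico 0 T, ∀ ξ, χ t ξ = optMap σ γ T φ (t, ξ))
    (hmem : ∀ t ∈ Ico 0 T, ∀ x : Vec n, (t, x) ∈ potDomain n (γ * l * maxEigenvalue σ ^ 2) T)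
    {t : ℝ} (ht : t ∈ Ico 0 T) (ξ : Vec n) :
    IsUnit (jacobian (χ t) ξ) ∧ ∀ i k, ((jacobian (χ t) ξ)⁻¹ * σ) k i =
      pd (dirS σ i) (invMap σ γ T (potential σ γ T φ)) (unshear σ γ T φ (t, ξ)) k := by
  have hD := h.isBurgers.isOpen
  set p := unshear σ γ T φ (t, ξ) with hp
  have hpD : p ∈ potDomain n (γ * l * maxEigenvalue σ ^ 2) T := hmem t ht (optMap σ γ T φ (t, ξ))
  have hsp : shear σ γ T (potential σ γ T φ) p = (t, ξ) := h.shear_unshear hn (hmem t ht ξ)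
  have hd := (h.contDiffOn_optMap hn).differentiableAt_of_isOpen hD (hmem t ht ξ)
  have hJ (i j : Fin n) : jacobian (χ t) ξ i j = pd (dirX j) (optMap σ γ T φ) (t, ξ) i := by
    rw [jacobian, Matrix.of_apply, partialDeriv,
      show (fun y => χ t y i) = fun y => (fun q => optMap σ γ T φ q i) (t, y) from
        funext fun y => by rw [hχ t ht]]
    have hdi : HasFDerivAt (fun q => optMap σ γ T φ q i)
        ((EuclideanSpace.proj i).comp (fderiv ℝ (optMap σ γ T φ) (t, ξ))) (t, ξ) :=
      (EuclideanSpace.proj (𝕜 := ℝ) i).hasFDerivAt.comp (t, ξ) hd.hasFDerivAt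
    rw [fderiv_slice hdi.differentiableAt, pd, hdi.fderiv]
    rfl
  set K : Matrix (Fin n) (Fin n) ℝ :=
    Matrix.of fun i j => pd (dirX j) (invMap σ γ T (potential σ γ T φ)) p i with hK
  have hJK : jacobian (χ t) ξ * K = 1 := by
    ext i j
    have h1 := h.pd_optMap_pd_invMap hn hpD (EuclideanSpace.single j 1)
    rw [hsp, pd_eq_sum] at h1
    have h2 := congrArg (fun x : Vec n => x i) h1
    simp only [WithLp.ofLp_sum, Finset.sum_apply, WithLp.ofLp_smul, Pi.smul_apply, smul_eq_mul,
      PiLp.single_apply] at h2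
    rw [Matrix.mul_apply, Matrix.one_apply, ← h2]
    refine Finset.sum_congr rfl fun k _ => ?_
    rw [hJ, hK, Matrix.of_apply, mul_comm]
    rfl
  refine ⟨IsUnit.of_mul_eq_one _ hJK, fun i k => ?_⟩
  rw [Matrix.inv_eq_right_inv hJK, Matrix.mul_apply, dirS, pd_eq_sum]
  simp only [WithLp.ofLp_sum, Finset.sum_apply, WithLp.ofLp_smul, Pi.smul_apply, smul_eq_mul]
  refine Finset.sum_congr rfl fun m _ => ?_
  rw [act_apply, hK, Matrix.of_apply, mul_comm]
  simp

/-- The parabolic operator applied to a function of the form `v(t, χ(t, ξ))`. -/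
lemma IsAdmissible.parabolicOp_comp (hχ : ∀ t ∈ Ico 0 T, ∀ ξ, χ t ξ = optMap σ γ T φ (t, ξ))
    (hmem : ∀ t ∈ Ico 0 T, ∀ x : Vec n, (t, x) ∈ potDomain n (γ * l * maxEigenvalue σ ^ 2) T)
    {u : ℝ → Vec n → ℝ} {v : ℝ × Vec n → ℝ}
    (hv : ContDiffOn ℝ ∞ v (potDomain n (γ * l * maxEigenvalue σ ^ 2) T))
    (hu : ∀ t ∈ Ico 0 T, ∀ ξ, u t ξ = v (t, χ t ξ)) :
    IsC12 T u ∧ ∀ t ∈ Ico 0 T, ∀ ξ, parabolicOp σ T χ u t ξ =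
      heatOp σ v (t, χ t ξ) + γ * ∑ i, act σ (spaceGrad (potential σ γ T φ) (t, χ t ξ)) i *
        pd (dirS σ i) v (t, χ t ξ) := by
  have hD := h.isBurgers.isOpen
  have hU : ContDiffOn ℝ ∞ (fun q => v (unshear σ γ T φ q))
      (potDomain n (γ * l * maxEigenvalue σ ^ 2) T) :=
    hv.comp (h.contDiffOn_unshear hn) fun q hq => hq
  have hext : IsSmoothExt T (potDomain n (γ * l * maxEigenvalue σ ^ 2) T) u
      (fun q => v (unshear σ γ T φ q)) :=
    ⟨hD, hU, hmem, fun t ht ξ => by rw [hu t ht, hχ t ht, unshear]⟩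
  refine ⟨hext.isC12, fun t ht ξ => ?_⟩
  have hpD : unshear σ γ T φ (t, ξ) ∈ potDomain n (γ * l * maxEigenvalue σ ^ 2) T :=
    hmem t ht (optMap σ γ T φ (t, ξ))
  rw [hext.parabolicOp_eq ht ξ (h.jacobian_inv_mul hn hχ hmem ht ξ).2,
    ← h.shear_unshear hn (hmem t ht ξ)]
  have h1 := h.isBurgers.parabolic_of_comp (T := T) hU (fun q hq => hq)
    (v := v) (fun q hq => by rw [h.unshear_shear hn hq]) hpD
  rw [h.shear_unshear hn (hmem t ht ξ)] at h1 ⊢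
  rw [h1, hχ t ht]
  simp only [h.pd_dirS hpD]
  rfl

end System

section Identification

/-! ### Identification of the functions attached to a payoff -/

open scoped RealInnerProductSpace ContDiff

variable {n : ℕ} {Ω : Type*} [MeasurableSpace Ω] {P : Measure Ω} [IsProbabilityMeasure P]
  {B : ℝ≥0 → Ω → Vec n} {σ : Matrix (Fin n) (Fin n) ℝ} {γ T A l : ℝ} {φ : Vec n → ℝ}

lemma small_of_lt (hn : 1 ≤ n) (hσ : σ.PosDef) (hγ : 0 < γ) (hT : 0 < T)
    (hl : l < 1 / (maxEigenvalue σ ^ 2 * γ * T)) : γ * l * maxEigenvalue σ ^ 2 * T < 1 := by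
  have := maxEigenvalue_pos hn hσ
  rw [lt_div_iff₀ (by positivity)] at hl
  linarith

lemma mem_admTimes (hγ : 0 < γ) (hl0 : 0 ≤ l) (hs : γ * l * maxEigenvalue σ ^ 2 * T < 1) {t : ℝ}
    (ht : t ∈ Icc 0 T) : t ∈ admTimes σ γ T l := by
  refine ⟨ht.2, lt_of_le_of_lt ?_ hs⟩
  have : 0 ≤ γ * l * maxEigenvalue σ ^ 2 := by positivity
  exact mul_le_mul_of_nonneg_left (by linarith [ht.1]) this

lemma exists_isAdmissible (hσ : σ.PosDef) (hγ : 0 < γ) (hl0 : 0 ≤ l) (hφ : φ ∈ ClassC n l) :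
    ∃ A, IsAdmissible σ γ T A l φ := by
  obtain ⟨C, hC⟩ := (isCompact_closedBall (0 : Vec n) 1).bddAbove_image
    hφ.1.continuous.continuousOn
  refine ⟨|C|, isPayoff_of_mem_classC hφ fun x hx => ?_, hσ, hγ, hl0, abs_nonneg C⟩
  exact (hC (mem_image_of_mem φ (by simpa using hx))).trans (le_abs_self C)

variable (hB : IsBrownianVec B P) (h : IsAdmissible σ γ T A l φ) (hn : 1 ≤ n)
  (hs : γ * l * maxEigenvalue σ ^ 2 * T < 1)

include hB h

lemma IsAdmissible.E_eq {t : ℝ} (ht : t ∈ Icc 0 T) :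
    E P B σ γ T φ t = fun z => potential σ γ T φ (t, z) :=
  funext fun z => (E_eq_potential hB h.payoff.differentiable.continuous ht z).1

lemma IsAdmissible.objective_eq {t : ℝ} (ht : t ∈ Icc 0 T) (ξ : Vec n) :
    objective P B σ γ T φ t ξ = penalized σ γ T φ t ξ := by
  funext z
  rw [objective, penalized, h.E_eq hB ht]

include hn hs

/-- The optimal map is the unique minimizer of the extended objective. At the horizon this holds
because the objective is infinite except at `ξ`. -/
lemma IsAdmissible.extObjective_lt {t : ℝ} (ht : t ∈ Icc 0 T) (ξ z : Vec n)
    (hz : z ≠ optMap σ γ T φ (t, ξ)) :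
    extObjective P B σ γ T φ t ξ (optMap σ γ T φ (t, ξ)) < extObjective P B σ γ T φ t ξ z := by
  have hadm := mem_admTimes h.gamma_pos h.l_nonneg hs ht
  rcases ht.2.eq_or_lt with hT | hlt
  · have hξ : optMap σ γ T φ (t, ξ) = ξ := h.optMap_eq hn hadm (by simp [invMap, hT])
    rw [hξ] at hz ⊢
    simp only [extObjective, hT, lt_irrefl, if_false, if_true, if_neg hz]
    exact EReal.coe_lt_top _
  · obtain ⟨z₀, hz₀, hmin⟩ := h.exists_isMin_penalized hn hadm hlt ξ
    rw [h.optMap_eq hn hadm hz₀] at hz ⊢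
    simp only [extObjective, hlt, if_true, h.objective_eq hB ht]
    exact EReal.coe_lt_coe_iff.2 (hmin z hz)

lemma IsAdmissible.chi_eq {t : ℝ} (ht : t ∈ Icc 0 T) (ξ : Vec n) :
    chi P B σ γ T φ t ξ = optMap σ γ T φ (t, ξ) := by
  have hlt := h.extObjective_lt hB hn hs ht ξ
  have hspec : ∀ w, extObjective P B σ γ T φ t ξ (chi P B σ γ T φ t ξ) ≤
      extObjective P B σ γ T φ t ξ w := by
    refine Classical.epsilon_spec (p := fun z => ∀ w, extObjective P B σ γ T φ t ξ z ≤
      extObjective P B σ γ T φ t ξ w) ⟨optMap σ γ T φ (t, ξ), fun w => ?_⟩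
    by_cases hw : w = optMap σ γ T φ (t, ξ)
    · rw [hw]
    · exact (hlt w hw).le
  by_contra hne
  exact absurd (hspec (optMap σ γ T φ (t, ξ))) (not_le.2 (hlt _ hne))

lemma IsAdmissible.gam_eq {t : ℝ} (ht : t ∈ Icc 0 T) (ξ : Vec n) :
    Gam P B σ γ T φ t ξ = potential σ γ T φ (t, optMap σ γ T φ (t, ξ)) := by
  rw [Gam, h.chi_eq hB hn hs ht, h.E_eq hB ht]

lemma IsAdmissible.price_eq {t : ℝ} (ht : t ∈ Icc 0 T) (ξ : Vec n) :
    price P B σ γ T φ t ξ = spaceGrad (potential σ γ T φ) (t, optMap σ γ T φ (t, ξ)) := by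
  rw [price, h.chi_eq hB hn hs ht, h.E_eq hB ht]
  rfl

omit hB in
lemma IsAdmissible.continuousOn_optMap : ContinuousOn (optMap σ γ T φ) (Icc 0 T ×ˢ univ) := by
  intro p hp
  exact h.tendsto_optMap hn (φs := fun _ => φ) (Eventually.of_forall fun _ => h)
    (fun _ x₀ hx => (h.payoff.differentiable.continuous.tendsto x₀).comp hx)
    (tendsto_id.mono_left nhdsWithin_le_nhds)
    (eventually_mem_nhdsWithin.mono fun q hq => mem_admTimes h.gamma_pos h.l_nonneg hs hq.1)
    (mem_admTimes h.gamma_pos h.l_nonneg hs hp.1)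

lemma IsAdmissible.isC0_chi (i : Fin n) : IsC0 T (fun t ξ => chi P B σ γ T φ t ξ i) :=
  ((EuclideanSpace.proj (𝕜 := ℝ) i).continuous.comp_continuousOn
    (h.continuousOn_optMap hn hs)).congr
    fun p hp => congrArg (fun x : Vec n => x i) (h.chi_eq hB hn hs hp.1 p.2)

lemma IsAdmissible.isC0_gam : IsC0 T (Gam P B σ γ T φ) := by
  have h1 : ContinuousOn (fun p => potential σ γ T φ (p.1, optMap σ γ T φ p))
      (Icc 0 T ×ˢ (univ : Set (Vec n))) := by
    intro p hp
    have hadm := mem_admTimes h.gamma_pos h.l_nonneg hs hp.1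
    have h2 := h.payoff.continuousAt_potential (T := T) h.posDef h.gamma_pos h.l_nonneg h.A_nonneg
      (p₀ := (p.1, optMap σ γ T φ p)) hadm.1 hadm.2
    exact ContinuousAt.comp_continuousWithinAt (f := fun p => (p.1, optMap σ γ T φ p)) h2
      (continuousWithinAt_fst.prodMk (h.continuousOn_optMap hn hs p hp))
  exact h1.congr fun p hp => h.gam_eq hB hn hs hp.1 p.2

lemma IsAdmissible.isC0_price (i : Fin n) : IsC0 T (fun t ξ => price P B σ γ T φ t ξ i) := by
  have h1 : ContinuousOn (fun p => spaceGrad (potential σ γ T φ) (p.1, optMap σ γ T φ p))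
      (Icc 0 T ×ˢ (univ : Set (Vec n))) := by
    intro p hp
    have hq : Tendsto (fun q : ℝ × Vec n => (q.1, optMap σ γ T φ q)) (𝓝[Icc 0 T ×ˢ univ] p)
        (𝓝 (p.1, optMap σ γ T φ p)) :=
      continuousWithinAt_fst.prodMk (h.continuousOn_optMap hn hs p hp)
    exact h.tendsto_spaceGrad (𝓕 := 𝓝[Icc 0 T ×ˢ univ] p) (φs := fun _ => φ)
      (Eventually.of_forall fun _ => h)
      (fun _ x₀ hx => (h.payoff.differentiable.continuous.tendsto x₀).comp hx) hq
      (eventually_mem_nhdsWithin.mono fun q hq => mem_admTimes h.gamma_pos h.l_nonneg hs hq.1)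
      (mem_admTimes h.gamma_pos h.l_nonneg hs hp.1)
  exact ((EuclideanSpace.proj (𝕜 := ℝ) i).continuous.comp_continuousOn h1).congr
    fun p hp => congrArg (fun x : Vec n => x i) (h.price_eq hB hn hs hp.1 p.2)

/-- Regularity before the horizon, and the system of equations. -/
lemma IsAdmissible.system :
    (∀ i, IsC12 T (fun t ξ => chi P B σ γ T φ t ξ i)) ∧ IsC12 T (Gam P B σ γ T φ) ∧
    (∀ i, IsC12 T (fun t ξ => price P B σ γ T φ t ξ i)) ∧
    ∀ t ∈ Ico 0 T, ∀ ξ, IsUnit (jacobian (chi P B σ γ T φ t) ξ) ∧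
      parabolicOp σ T (chi P B σ γ T φ) (Gam P B σ γ T φ) t ξ =
        γ * ‖act σ (price P B σ γ T φ t ξ)‖ ^ 2 / 2 ∧
      (∀ i, parabolicOp σ T (chi P B σ γ T φ) (fun s η => chi P B σ γ T φ s η i) t ξ =
        γ * (act (σ ^ 2) (price P B σ γ T φ t ξ)) i) ∧
      (∀ i, parabolicOp σ T (chi P B σ γ T φ) (fun s η => price P B σ γ T φ s η i) t ξ = 0) := by
  have hD := h.isBurgers.isOpen
  have hχ : ∀ t ∈ Ico 0 T, ∀ ξ, chi P B σ γ T φ t ξ = optMap σ γ T φ (t, ξ) :=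
    fun t ht ξ => h.chi_eq hB hn hs (Ico_subset_Icc_self ht) ξ
  have hmem : ∀ t ∈ Ico 0 T, ∀ x : Vec n,
      (t, x) ∈ potDomain n (γ * l * maxEigenvalue σ ^ 2) T := fun t ht x =>
    ⟨ht.2, (mem_admTimes h.gamma_pos h.l_nonneg hs (Ico_subset_Icc_self ht)).2⟩
  have hprice : ∀ t ∈ Ico 0 T, ∀ ξ, price P B σ γ T φ t ξ =
      spaceGrad (potential σ γ T φ) (t, chi P B σ γ T φ t ξ) := fun t ht ξ => by
    rw [hχ t ht, h.price_eq hB hn hs (Ico_subset_Icc_self ht)]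
  have cchi (i : Fin n) := h.parabolicOp_comp hn hχ hmem (v := fun p => p.2 i)
    (u := fun s η => chi P B σ γ T φ s η i)
    ((EuclideanSpace.proj (𝕜 := ℝ) i).contDiff.comp contDiff_snd).contDiffOn fun _ _ _ => rfl
  have cgam := h.parabolicOp_comp hn hχ hmem (u := Gam P B σ γ T φ) h.isBurgers.contDiffOn
    fun t ht ξ => by rw [hχ t ht, h.gam_eq hB hn hs (Ico_subset_Icc_self ht)]
  have cprice (i : Fin n) := h.parabolicOp_comp hn hχ hmem
    (u := fun s η => price P B σ γ T φ s η i) (contDiffOn_pd hD h.isBurgers.contDiffOn (dirX i))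
    fun t ht ξ => by
      simp only [hprice t ht]
      rw [spaceGrad_apply]
      exact fderiv_slice (h.isBurgers.contDiffOn.differentiableAt_of_isOpen hD (hmem t ht _)) _
  refine ⟨fun i => (cchi i).1, cgam.1, fun i => (cprice i).1, fun t ht ξ =>
    ⟨(h.jacobian_inv_mul hn hχ hmem ht ξ).1, ?_, fun i => ?_, fun i => ?_⟩⟩
  · have hp := hmem t ht (chi P B σ γ T φ t ξ)
    rw [cgam.2 t ht ξ, h.isBurgers.heatOp_eq _ hp, hprice t ht, EuclideanSpace.real_norm_sq_eq]
    simp only [h.pd_dirS hp, ← sq]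
    ring
  · have hcoord (w q : ℝ × Vec n) : pd w (fun p : ℝ × Vec n => p.2 i) q = w.2 i := by
      have : HasFDerivAt (fun p : ℝ × Vec n => p.2 i)
          ((EuclideanSpace.proj i).comp (ContinuousLinearMap.snd ℝ ℝ (Vec n))) q :=
        (EuclideanSpace.proj (𝕜 := ℝ) i).hasFDerivAt.comp q hasFDerivAt_snd
      rw [pd, this.fderiv]
      rfl
    have hconst (w w' q : ℝ × Vec n) : pd w (pd w' (fun p : ℝ × Vec n => p.2 i)) q = 0 := by
      rw [funext (hcoord w')]; simp [pd]
    rw [(cchi i).2 t ht ξ, heatOp, hprice t ht, sq, act_mul]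
    simp only [hcoord, hconst]
    have hsum (y : Vec n) : ∑ j, y j * (dirS σ j).2 i = act σ y i := by
      rw [act_apply]
      refine Finset.sum_congr rfl fun j _ => ?_
      simp [dirS, act_apply, mul_comm]
    rw [hsum]
    simp
  · have hp := hmem t ht (chi P B σ γ T φ t ξ)
    rw [(cprice i).2 t ht ξ, h.isBurgers.heatOp_pd _ hp]
    simp only [h.pd_dirS hp]
    ring

end Identification

section Stability

/-! ### Dependence on the payoff -/

variable {n : ℕ} {σ : Matrix (Fin n) (Fin n) ℝ} {γ T l : ℝ} {φ : Vec n → ℝ}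
  {φs : ℕ → Vec n → ℝ}

/-- A locally uniformly convergent sequence in `C_l` is eventually admissible with a common linear
growth constant, which it shares with its limit. -/
lemma exists_isAdmissible_of_tendsto (hσ : σ.PosDef) (hγ : 0 < γ) (hl0 : 0 ≤ l)
    (hφs : ∀ k, φs k ∈ ClassC n l) (hφ : φ ∈ ClassC n l)
    (hlim : ∀ K : Set (Vec n), IsCompact K → TendstoUniformlyOn φs φ atTop K) :
    ∃ A, IsAdmissible σ γ T A l φ ∧ ∀ᶠ k in atTop, IsAdmissible σ γ T A l (φs k) := by
  have hK := isCompact_closedBall (0 : Vec n) 1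
  obtain ⟨C, hC⟩ := hK.bddAbove_image hφ.1.continuous.continuousOn
  have hC' (x : Vec n) (hx : ‖x‖ ≤ 1) : φ x ≤ |C| :=
    (hC (mem_image_of_mem φ (by simpa using hx))).trans (le_abs_self C)
  refine ⟨|C| + 1, ⟨isPayoff_of_mem_classC hφ fun x hx => ?_, hσ, hγ, hl0, by positivity⟩, ?_⟩
  · linarith [hC' x hx]
  · filter_upwards [Metric.tendstoUniformlyOn_iff.1 (hlim _ hK) 1 one_pos] with k hk
    refine ⟨isPayoff_of_mem_classC (hφs k) fun x hx => ?_, hσ, hγ, hl0, by positivity⟩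
    have h1 := hk x (by simpa using hx)
    rw [Real.dist_eq] at h1
    linarith [(abs_lt.1 h1).1, hC' x hx]

lemma tendsto_apply_of_tendstoUniformlyOn (hφ : Continuous φ)
    (hlim : ∀ K : Set (Vec n), IsCompact K → TendstoUniformlyOn φs φ atTop K)
    (x : ℕ → Vec n) (x₀ : Vec n) (hx : Tendsto x atTop (𝓝 x₀)) :
    Tendsto (fun k => φs k (x k)) atTop (𝓝 (φ x₀)) := by
  have hmem : ∀ᶠ k in atTop, x k ∈ Metric.closedBall x₀ 1 :=
    hx.eventually_mem (Metric.closedBall_mem_nhds x₀ one_pos)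
  exact (hlim _ (isCompact_closedBall x₀ 1)).tendstoLocallyUniformlyOn.tendsto_comp
    hφ.continuousWithinAt (Metric.mem_closedBall_self zero_le_one)
    (tendsto_nhdsWithin_iff.2 ⟨hx, hmem⟩)

end Stability

end KyleBack

theorem mainTheorem3 {n : ℕ} (hn : 1 ≤ n) {Ω : Type*} [MeasurableSpace Ω]
    (P : Measure Ω) [IsProbabilityMeasure P]
    (B : ℝ≥0 → Ω → Vec n) (hB : IsBrownianVec B P)
    (σ : Matrix (Fin n) (Fin n) ℝ) (hσ : σ.PosDef)
    (γ T l : ℝ) (hγ : 0 < γ) (hT : 0 < T) (hl0 : 0 ≤ l)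
    (hl : l < 1 / (maxEigenvalue σ ^ 2 * γ * T)) :
    -- properties of the functions attached to one `φ` in the class
    (∀ φ ∈ ClassC n l,
      -- `E` is well defined and differentiable in `z`
      (∀ t ∈ Icc 0 T, ∀ z,
        Integrable (expPayoff B σ γ T φ t z) P ∧
        DifferentiableAt ℝ (E P B σ γ T φ t) z) ∧
      -- strong convexity in `z` for `t < T`
      (∀ t ∈ Ico 0 T, ∃ m > 0, ∀ ξ,
        StrongConvexOn univ m (fun z => objective P B σ γ T φ t ξ z)) ∧
      -- `χ(t,ξ)` is the unique minimizer
      (∀ t ∈ Icc 0 T, ∀ ξ z, z ≠ chi P B σ γ T φ t ξ →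
        extObjective P B σ γ T φ t ξ (chi P B σ γ T φ t ξ) < extObjective P B σ γ T φ t ξ z) ∧
      -- regularity
      (∀ i, IsC12 T (fun t ξ => chi P B σ γ T φ t ξ i) ∧
        IsC0 T (fun t ξ => chi P B σ γ T φ t ξ i)) ∧
      (IsC12 T (Gam P B σ γ T φ) ∧ IsC0 T (Gam P B σ γ T φ)) ∧
      (∀ i, IsC12 T (fun t ξ => price P B σ γ T φ t ξ i) ∧
        IsC0 T (fun t ξ => price P B σ γ T φ t ξ i)) ∧
      -- the system of equations on `[0,T) × ℝⁿ`
      (∀ t ∈ Ico 0 T, ∀ ξ,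
        IsUnit (jacobian (chi P B σ γ T φ t) ξ) ∧
        parabolicOp σ T (chi P B σ γ T φ) (Gam P B σ γ T φ) t ξ =
          γ * ‖act σ (price P B σ γ T φ t ξ)‖ ^ 2 / 2 ∧
        (∀ i, parabolicOp σ T (chi P B σ γ T φ) (fun s η => chi P B σ γ T φ s η i) t ξ =
          γ * (act (σ ^ 2) (price P B σ γ T φ t ξ)) i) ∧
        (∀ i, parabolicOp σ T (chi P B σ γ T φ) (fun s η => price P B σ γ T φ s η i) t ξ = 0)) ∧
      -- terminal conditions
      (∀ ξ, price P B σ γ T φ T ξ = gradient φ ξ ∧ chi P B σ γ T φ T ξ = ξ ∧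
        Gam P B σ γ T φ T ξ = φ ξ)) ∧
    -- continuous dependence on `φ`
    (∀ (φs : ℕ → Vec n → ℝ) (φ : Vec n → ℝ), (∀ k, φs k ∈ ClassC n l) → φ ∈ ClassC n l →
      (∀ K : Set (Vec n), IsCompact K → TendstoUniformlyOn φs φ atTop K) →
      Tendsto (fun k => (Gam P B σ γ T (φs k) 0 0, chi P B σ γ T (φs k) 0 0)) atTop
        (𝓝 (Gam P B σ γ T φ 0 0, chi P B σ γ T φ 0 0))) := by
  have hs := small_of_lt hn hσ hγ hT hl
  refine ⟨fun φ hφ => ?_, fun φs φ hφs hφ hlim => ?_⟩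
  · obtain ⟨A, h⟩ := exists_isAdmissible (T := T) hσ hγ hl0 hφ
    have hadm {t : ℝ} (ht : t ∈ Icc 0 T) := mem_admTimes (σ := σ) hγ hl0 hs ht
    obtain ⟨hchi, hgam, hprice, hsys⟩ := h.system hB hn hs
    refine ⟨fun t ht z => ⟨?_, ?_⟩, fun t ht => ?_, fun t ht ξ z hz => ?_,
      fun i => ⟨hchi i, h.isC0_chi hB hn hs i⟩, ⟨hgam, h.isC0_gam hB hn hs⟩,
      fun i => ⟨hprice i, h.isC0_price hB hn hs i⟩, hsys, fun ξ => ?_⟩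
    · exact (E_eq_potential hB h.payoff.differentiable.continuous ht z).2.2
        (h.payoff.integrable_exp hσ hγ hl0 h.A_nonneg (sub_nonneg.2 ht.2) (hadm ht).2 z)
    · rw [h.E_eq hB ht]
      exact h.differentiable (hadm ht) z
    · have htI := Ico_subset_Icc_self ht
      have hΛ := maxEigenvalue_pos hn hσ
      have hTt : 0 < T - t := sub_pos.2 ht.2
      refine ⟨2 * (1 / (2 * γ * (T - t)) / maxEigenvalue σ ^ 2), by positivity, fun ξ => ?_⟩
      rw [h.objective_eq hB htI]
      exact h.strongConvexOn_penalized hn (hadm htI) ht.2 ξ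
    · rw [h.chi_eq hB hn hs ht] at hz ⊢
      exact h.extObjective_lt hB hn hs ht ξ z hz
    · have hTI : T ∈ Icc 0 T := right_mem_Icc.2 hT.le
      have hξ : optMap σ γ T φ (T, ξ) = ξ := h.optMap_eq hn (hadm hTI) (by simp [invMap])
      refine ⟨?_, by rw [h.chi_eq hB hn hs hTI, hξ], ?_⟩
      · rw [h.price_eq hB hn hs hTI, hξ, spaceGrad]
        simp only [potential_terminal hγ.ne']
      · rw [h.gam_eq hB hn hs hTI, hξ, potential_terminal hγ.ne']
  · obtain ⟨A, h, hk⟩ := exists_isAdmissible_of_tendsto (T := T) hσ hγ hl0 hφs hφ hlim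
    have h0 : (0 : ℝ) ∈ Icc 0 T := left_mem_Icc.2 hT.le
    have hadm := mem_admTimes (σ := σ) hγ hl0 hs h0
    have hcont := tendsto_apply_of_tendstoUniformlyOn h.payoff.differentiable.continuous hlim
    have hX : Tendsto (fun k => optMap σ γ T (φs k) (0, 0)) atTop (𝓝 (optMap σ γ T φ (0, 0))) :=
      h.tendsto_optMap hn hk hcont tendsto_const_nhds (Eventually.of_forall fun _ => hadm) hadm
    have hG := tendsto_potential (T := T) (p := fun k => (0, optMap σ γ T (φs k) (0, 0)))
      (p₀ := (0, optMap σ γ T φ (0, 0))) (hk.mono fun k hk => hk.payoff) h.payoff hcont hσ hγ hl0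
      h.A_nonneg (tendsto_const_nhds.prodMk_nhds hX) hadm.1 hadm.2
    rw [h.gam_eq hB hn hs h0, h.chi_eq hB hn hs h0]
    refine (hG.prodMk_nhds hX).congr' ?_
    filter_upwards [hk] with k hk
    rw [hk.gam_eq hB hn hs h0, hk.chi_eq hB hn hs h0]
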